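/- Let $\mathsf k$ be an infinite field, $R=\mathsf k[s,t]$, and let $R_n$ be the space of homogeneous polynomials of degree $n$ in $R$. Let $d\ge 2$, and let $\mu=(\mu_1,\dots,\mu_d)$ be integers with $1\le\mu_1\le\cdots\le\mu_d$ and $\mu_1+\cdots+\mu_d=n$. Let $\mathcal P_{n,d}\subseteq R_n^{d+1}$ be the set of tuples $(a_0,\dots,a_d)$ that are linearly independent over $\mathsf k$ and relatively prime. The $\mu$-stratum $\mathcal P^{\mu}_{n,d}\subseteq\mathcal P_{n,d}$ consists of the tuples of $\mu$-type $\mu$, i.e. those for which there is an exact sequence of graded $R$-modules $$0\to\bigoplus_{i=1}^d R(-n-\mu_i)\xrightarrow{\;A\;} R(-n)^{d+1}\xrightarrow{(a_0,\dots,a_d)}\langle a_0,\dots,a_d\rangle\to 0 .$$ A tuple in $\mathcal P_{n,d}$ defines a parametrization $F=(a_0:\cdots:a_d):\mathbb P^1\to\mathbb P^d$ with image curve $C$. It has generic degree $r$ if, over the algebraic closure $\overline{\mathsf k}$, all but finitely many points of $C(\overline{\mathsf k})$ have exactly $r$ preimages in $\mathbb P^1(\overline{\mathsf k})$. Let $k>1$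 be an integer. Then $\mathcal P^{\mu}_{n,d}$ contains a parametrization of generic degree $k$ if and only if $k\mid\mu_i$ for all $i=1,\dots,d$. The same equivalence holds if the generic degree of $F$ is understood as the degree $[\mathsf k(\mathbb P^1):\mathsf k(C)]$ of $F$ onto its image (the two notions agree in characteristic $0$). -/

import Mathlib

namespace RationalCurve

open MvPolynomial
open scoped LinearAlgebra.Projectivization

/-- `P_{n,d}`: the tuples `(a_0, …, a_d)` of homogeneous polynomials of degree `n` in `K[s,t]`
(`s = X 0`, `t = X 1`) that are linearly independent over `K` and relatively prime. -/
def param (K : Type*) [Field K] (n d : ℕ) : Set (Fin (d + 1) → MvPolynomial (Fin 2) K) :=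
  {a | (∀ i, (a i).IsHomogeneous n) ∧ LinearIndependent K a ∧
    ∀ g : MvPolynomial (Fin 2) K, (∀ i, g ∣ a i) → IsUnit g}

/-- `(a_0, …, a_d)` has `μ`-type `μ = (μ_1 ≤ ⋯ ≤ μ_d)`: for some matrix `A` whose `j`-th column is
homogeneous of degree `μ_j`, the sequence `0 → R^d → R^(d+1) → R`, given by `A` and by
`(c_i) ↦ ∑ c_i a_i`, is exact.  (The image of the last map is the ideal `⟨a_0, …, a_d⟩`.) -/
def HasMuType {K : Type*} [Field K] {d : ℕ} (a : Fin (d + 1) → MvPolynomial (Fin 2) K)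
    (μ : Fin d → ℕ) : Prop :=
  Monotone μ ∧ (∀ i, 1 ≤ μ i) ∧
    ∃ A : Matrix (Fin (d + 1)) (Fin d) (MvPolynomial (Fin 2) K),
      (∀ i j, (A i j).IsHomogeneous (μ j)) ∧
      Function.Injective A.mulVecLin ∧
      Function.Exact A.mulVecLin (Fintype.linearCombination (MvPolynomial (Fin 2) K) a)

/-- The `μ`-stratum of `P_{n,d}`. -/
def stratum (K : Type*) [Field K] (n d : ℕ) (μ : Fin d → ℕ) :
    Set (Fin (d + 1) → MvPolynomial (Fin 2) K) :=
  {a | a ∈ param K n d ∧ HasMuType a μ}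

/-- The graph of `F : ℙ¹ ⇢ ℙᵈ`, `(s : t) ↦ (a_0(s,t) : ⋯ : a_d(s,t))`, on points over the
algebraic closure of `K`: `F` is defined at `P`, and `F(P) = Q`. For homogeneous `a_i` of the same
degree this does not depend on the representative of `P`. -/
def MapsTo {K : Type*} [Field K] {d : ℕ} (a : Fin (d + 1) → MvPolynomial (Fin 2) K)
    (P : ℙ (AlgebraicClosure K) (Fin 2 → AlgebraicClosure K))
    (Q : ℙ (AlgebraicClosure K) (Fin (d + 1) → AlgebraicClosure K)) : Prop :=
  ∃ h : (fun i => aeval P.rep (a i)) ≠ 0, Projectivization.mk (AlgebraicClosure K) _ h = Q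

/-- The parametrization has generic degree `k`: all but finitely many points of the image curve
(over the algebraic closure) have exactly `k` points in their preimage. -/
def HasGenericDegree {K : Type*} [Field K] {d : ℕ}
    (a : Fin (d + 1) → MvPolynomial (Fin 2) K) (k : ℕ) : Prop :=
  {Q | (∃ P, MapsTo a P Q) ∧ {P | MapsTo a P Q}.encard ≠ k}.Finite

/-- The function field `K(C)` of the image curve `C`, inside the function field `K(x)`, `x = s/t`,
of `ℙ¹`: it is generated over `K` by the ratios `a_i(x,1) / a_j(x,1)` with `a_j ≠ 0`
(ratios with `a_j = 0` are `0` by convention and add nothing). -/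
noncomputable def imageField {K : Type*} [Field K] {d : ℕ}
    (a : Fin (d + 1) → MvPolynomial (Fin 2) K) : IntermediateField K (RatFunc K) :=
  IntermediateField.adjoin K
    {f | ∃ i j, f = aeval ![RatFunc.X, 1] (a i) / aeval ![RatFunc.X, 1] (a j)}

/-- The degree `[K(ℙ¹) : K(C)]` of the parametrization as a map onto its image curve `C`. -/
noncomputable def mapDegree {K : Type*} [Field K] {d : ℕ}
    (a : Fin (d + 1) → MvPolynomial (Fin 2) K) : ℕ :=
  Module.finrank (imageField a) (RatFunc K)

end RationalCurve

namespace RationalCurve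

open Polynomial

/-! Necessity. By Lüroth the function field of the image curve is `K(h)` with `h = p/q` in lowest
terms, and `D = max (deg p) (deg q)` is the degree of the map onto its image. Let `P`, `Q` be the
forms of degree `D` homogenizing `p`, `q`. Up to nonzero factors the tuple `a` consists of forms in
`P` and `Q`, so it has the same syzygies as a tuple coming from `K[P, Q]`. Since `P, Q` is a regular
sequence whose quotient is spanned by monomials, `R` is free over `K[P, Q]` (`free_pairHom`).
Expanding a column of `A` in a basis therefore writes it as an `R`-combination of syzygies with
entries in `K[P, Q]`. Such syzygies have no component in a degree not divisible by `D`, whereas by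
minimality one of them must involve the column with a nonzero constant coefficient. Hence `D ∣ μ j`
(`dvd_of_exact_of_proportional`, `dvd_muType_of_imageField_eq`).

For geometric fibres, the curve's parametrization and `h` identify the same points up to finitely
many exceptions (`exists_finite_proportional_iff_cross`). The general fibre of `h` has `s` points
with `s ∣ D`, and `s = D` unless `p` and `q` both have zero derivative; removing Frobenius factors
proves this (`exists_encard_cross`). So a generic degree divides `D`, hence every `μ j`.

Sufficiency. Put `ν j = μ j / k`, `h = X ^ k + X`, and take monic `g j` of degree `ν j`. The
bidiagonal matrix with entries the homogenized `g j ∘ h` and `-t ^ μ j` has column degrees `μ j`,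
and its maximal minors, up to sign, form a tuple whose syzygies are exactly its columns
(`bidiagonal_exact`). Dehomogenized, the tuple consists of partial products of the `g j ∘ h`, so its
image field lies in `K(h)`. Choosing `g 0 = X ^ m` and `g 1 = X ^ (e + 1) + X ^ e` makes it all of
`K(h)` (`mem_of_pow_mem_of_transcendental`), in every characteristic; and `h` is separable of degree
`k`. -/

/-- One step of a regular sequence: independence over `S` modulo `I + (x)` lifts to independence
over `S[x]` modulo `I`. Reducing modulo `x` kills the constant coefficients; then `x` can be
cancelled and the degree drops. -/
theorem eq_zero_of_sum_eval₂_mul_mem {S R ι : Type*} [CommRing S] [CommRing R] (φ : S →+* R)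
    (I : Ideal R) (x : R) (hx : ∀ r, x * r ∈ I → r ∈ I) (s : Finset ι) (v : ι → R)
    (hv : ∀ c : ι → S, ∑ i ∈ s, φ (c i) * v i ∈ I ⊔ Ideal.span {x} → ∀ i ∈ s, c i = 0)
    (g : ι → S[X]) (hg : ∑ i ∈ s, (g i).eval₂ φ x * v i ∈ I) : ∀ i ∈ s, g i = 0 := by
  suffices H : ∀ N : ℕ, ∀ g : ι → S[X], (∀ i ∈ s, ∀ n, N ≤ n → (g i).coeff n = 0) →
      ∑ i ∈ s, (g i).eval₂ φ x * v i ∈ I → ∀ i ∈ s, g i = 0 by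
    refine H (s.sup (fun i => (g i).natDegree) + 1) g (fun i hi n hn => ?_) hg
    refine coeff_eq_zero_of_natDegree_lt (lt_of_lt_of_le (Nat.lt_succ_of_le ?_) hn)
    exact Finset.le_sup (f := fun i => (g i).natDegree) hi
  intro N
  induction N with
  | zero =>
    intro g h _ i hi
    ext n
    exact h i hi n (Nat.zero_le n)
  | succ N ih =>
    intro g h hg
    have key : ∑ i ∈ s, (g i).eval₂ φ x * v i =
        x * (∑ i ∈ s, ((g i).divX).eval₂ φ x * v i) + ∑ i ∈ s, φ ((g i).coeff 0) * v i := by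
      rw [Finset.mul_sum, ← Finset.sum_add_distrib]
      refine Finset.sum_congr rfl fun i _ => ?_
      conv_lhs => rw [← divX_mul_X_add (g i)]
      rw [eval₂_add, eval₂_mul_X, eval₂_C]
      ring
    have h0 : ∀ i ∈ s, (g i).coeff 0 = 0 := by
      apply hv
      have : ∑ i ∈ s, φ ((g i).coeff 0) * v i = ∑ i ∈ s, (g i).eval₂ φ x * v i -
        x * (∑ i ∈ s, ((g i).divX).eval₂ φ x * v i) := by rw [key]; ring
      rw [this]
      exact sub_mem (Ideal.mem_sup_left hg) (Ideal.mem_sup_right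
        (Ideal.mul_mem_right _ _ (Ideal.mem_span_singleton_self x)))
    have h1 : ∑ i ∈ s, φ ((g i).coeff 0) * v i = 0 :=
      Finset.sum_eq_zero fun i hi => by rw [h0 i hi, map_zero, zero_mul]
    rw [key, h1, add_zero] at hg
    have h2 := ih (fun i => (g i).divX) (fun i hi n hn => by
      rw [coeff_divX]; exact h i hi _ (by omega)) (hx _ hg)
    intro i hi
    rw [← divX_mul_X_add (g i), h2 i hi, h0 i hi]
    simp

/-! ### Homogeneous components of products. -/

section Homogeneous

variable {σ R : Type*} [CommRing R]

theorem homogeneousComponent_mul_of_le {P : MvPolynomial σ R} {m e : ℕ} (hP : P.IsHomogeneous m)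
    (f : MvPolynomial σ R) (h : m ≤ e) :
    MvPolynomial.homogeneousComponent e (P * f) =
      P * MvPolynomial.homogeneousComponent (e - m) f := by
  let _ := MvPolynomial.gradedAlgebra (σ := σ) (R := R)
  have := DirectSum.coe_decompose_mul_of_left_mem_of_le
    (MvPolynomial.homogeneousSubmodule σ R) (a := P) (b := f) hP h
  simpa only [DirectSum.decompose, Equiv.coe_fn_mk,
    MvPolynomial.decomposition.decompose'_apply] using this

theorem homogeneousComponent_mul_of_lt {P : MvPolynomial σ R} {m e : ℕ} (hP : P.IsHomogeneous m)
    (f : MvPolynomial σ R) (h : e < m) :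
    MvPolynomial.homogeneousComponent e (P * f) = 0 := by
  let _ := MvPolynomial.gradedAlgebra (σ := σ) (R := R)
  have := DirectSum.coe_decompose_mul_of_left_mem_of_not_le
    (MvPolynomial.homogeneousSubmodule σ R) (a := P) (b := f) hP (not_le.mpr h)
  simpa only [DirectSum.decompose, Equiv.coe_fn_mk,
    MvPolynomial.decomposition.decompose'_apply] using this

theorem mem_of_homogeneousComponent_mem {M : Type*} [SetLike M (MvPolynomial σ R)]
    [AddSubmonoidClass M (MvPolynomial σ R)] (N : M)
    {f : MvPolynomial σ R} (h : ∀ e, MvPolynomial.homogeneousComponent e f ∈ N) : f ∈ N := by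
  rw [← MvPolynomial.sum_homogeneousComponent f]
  exact sum_mem fun e _ => h e

end Homogeneous

/-! ### Homogenizing a coprime pair gives a regular sequence. -/

section Pair

variable {K : Type*} [Field K] {p q : K[X]} {D : ℕ}

theorem homogenize_ne_zero (hp : p ≠ 0) (hpD : p.natDegree ≤ D) : p.homogenize D ≠ 0 :=
  fun h => hp (eq_zero_of_homogenize_eq_zero hpD h)

theorem natDegree_aeval_le {f : MvPolynomial (Fin 2) K} {n : ℕ} (hf : f.IsHomogeneous n) :
    (MvPolynomial.aeval ![X, 1] f : K[X]).natDegree ≤ n := by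
  rw [MvPolynomial.aeval_def, MvPolynomial.eval₂_eq']
  refine natDegree_sum_le_of_forall_le _ _ fun m hm => ?_
  have hm' : m.degree = n := by
    by_contra h
    exact (MvPolynomial.mem_support_iff.mp hm) (hf.coeff_eq_zero h)
  rw [Finsupp.degree_eq_sum, Fin.sum_univ_two] at hm'
  simp only [Fin.prod_univ_two, algebraMap_eq]
  refine (natDegree_C_mul_le _ _).trans ?_
  simp
  omega

theorem homogenize_aeval {f : MvPolynomial (Fin 2) K} {n : ℕ} (hf : f.IsHomogeneous n) :
    (MvPolynomial.aeval ![X, 1] f : K[X]).homogenize n = f :=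
  homogenize_eq_of_isHomogeneous hf rfl

theorem aeval_inj {f g : MvPolynomial (Fin 2) K} {n : ℕ} (hf : f.IsHomogeneous n)
    (hg : g.IsHomogeneous n)
    (h : (MvPolynomial.aeval ![X, 1] f : K[X]) = MvPolynomial.aeval ![X, 1] g) : f = g := by
  rw [← homogenize_aeval hf, h, homogenize_aeval hg]

/-- Componentwise, setting `t = 1` reduces the claim to coprimality of `p` and `q`. The only danger
is a common factor `t`, which is excluded because one of `p`, `q` has degree exactly `D`. -/
theorem homogenize_dvd_of_dvd_mul (hpq : IsCoprime p q) (hp0 : p ≠ 0) (hq0 : q ≠ 0)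
    (hD : max p.natDegree q.natDegree = D) {r : MvPolynomial (Fin 2) K}
    (h : p.homogenize D ∣ q.homogenize D * r) : p.homogenize D ∣ r := by
  have hpD : p.natDegree ≤ D := hD ▸ le_max_left _ _
  have hqD : q.natDegree ≤ D := hD ▸ le_max_right _ _
  rw [← Ideal.mem_span_singleton]
  refine mem_of_homogeneousComponent_mem _ fun e => ?_
  rw [Ideal.mem_span_singleton]
  obtain ⟨w, hw⟩ := h
  set r' := MvPolynomial.homogeneousComponent e r
  set w' := MvPolynomial.homogeneousComponent e w
  have hr : r'.IsHomogeneous e := MvPolynomial.homogeneousComponent_isHomogeneous e r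
  have hww : w'.IsHomogeneous e := MvPolynomial.homogeneousComponent_isHomogeneous e w
  have h1 : q.homogenize D * r' = p.homogenize D * w' := by
    have := congrArg (MvPolynomial.homogeneousComponent (D + e)) hw
    rwa [homogeneousComponent_mul_of_le (isHomogeneous_homogenize q) _ (by omega),
      homogeneousComponent_mul_of_le (isHomogeneous_homogenize p) _ (by omega),
      Nat.add_sub_cancel_left] at this
  have h2 := congrArg (MvPolynomial.aeval (R := K) ![(X : K[X]), 1]) h1
  rw [map_mul, map_mul, aeval_homogenize_X_one _ hpD, aeval_homogenize_X_one _ hqD] at h2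
  obtain ⟨u, hu⟩ : p ∣ MvPolynomial.aeval (R := K) ![(X : K[X]), 1] r' :=
    hpq.dvd_of_dvd_mul_left ⟨_, h2⟩
  have hu' : MvPolynomial.aeval (R := K) ![(X : K[X]), 1] w' = q * u := by
    apply mul_left_cancel₀ hp0
    rw [← h2, hu]; ring
  by_cases hu0 : u = 0
  · rw [hu0, mul_zero] at hu
    rw [← homogenize_aeval hr, hu, homogenize_zero]
    exact dvd_zero _
  -- Whichever of `p`, `q` attains degree `D` gives this bound, which leaves room to homogenize `u`
  -- to degree `e - D`.
  have hdeg : D + u.natDegree ≤ e := by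
    have e1 := natDegree_aeval_le hr
    have e2 := natDegree_aeval_le hww
    rw [hu, natDegree_mul hp0 hu0] at e1
    rw [hu', natDegree_mul hq0 hu0] at e2
    omega
  refine ⟨u.homogenize (e - D), ?_⟩
  rw [← homogenize_mul _ _ hpD (by omega), ← hu, Nat.add_sub_cancel' (by omega),
    homogenize_aeval hr]

end Pair

/-! ### Freeness of `K[s, t]` over `K[P, Q]`. -/

section Free

variable {K : Type*} [Field K]

/-- The ring homomorphism `K[u][v] → R` over `K` that sends `u` to `Q` and `v` to `P`. -/
noncomputable def pairHom (P Q : MvPolynomial (Fin 2) K) : K[X][X] →+* MvPolynomial (Fin 2) K :=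
  eval₂RingHom (eval₂RingHom MvPolynomial.C Q) P

@[simp]
theorem pairHom_C_C (P Q : MvPolynomial (Fin 2) K) (c : K) :
    pairHom P Q (C (C c)) = MvPolynomial.C c := by simp [pairHom]

@[simp]
theorem pairHom_X (P Q : MvPolynomial (Fin 2) K) : pairHom P Q X = P := by simp [pairHom]

@[simp]
theorem pairHom_C_X (P Q : MvPolynomial (Fin 2) K) : pairHom P Q (C X) = Q := by simp [pairHom]

theorem homogeneousComponent_pairHom_eq_zero {P Q : MvPolynomial (Fin 2) K} {D e : ℕ}
    (hP : P.IsHomogeneous D) (hQ : Q.IsHomogeneous D) (he : ¬ D ∣ e) (g : K[X][X]) :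
    MvPolynomial.homogeneousComponent e (pairHom P Q g) = 0 := by
  induction g using Polynomial.induction_on' with
  | add f g hf hg => rw [map_add, map_add, hf, hg, add_zero]
  | monomial n a =>
    induction a using Polynomial.induction_on' with
    | add f g hf hg => rw [map_add, map_add, map_add, hf, hg, add_zero]
    | monomial m c =>
      rw [← C_mul_X_pow_eq_monomial, ← C_mul_X_pow_eq_monomial]
      simp only [map_mul, map_pow, pairHom_C_C, pairHom_C_X, pairHom_X]
      rw [MvPolynomial.homogeneousComponent_of_mem
        (((hQ.pow m).C_mul c).mul (hP.pow n)), if_neg]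
      rintro rfl
      exact he (by rw [← mul_add]; exact dvd_mul_right _ _)

/-- The lifting lemma is applied twice: from `(P, Q)` to `(P)` by regularity of `Q` modulo `P`, then
from `(P)` to `0`. -/
theorem eq_zero_of_sum_pairHom_mul {P Q : MvPolynomial (Fin 2) K} (hP0 : P ≠ 0)
    (hPQ : ∀ r, P ∣ Q * r → P ∣ r) {ι : Type*} (v : ι → MvPolynomial (Fin 2) K)
    (hv : LinearIndependent K (fun i => Ideal.Quotient.mkₐ K (Ideal.span {P, Q}) (v i)))
    (s : Finset ι) (c : ι → K[X][X]) (h : ∑ i ∈ s, pairHom P Q (c i) * v i = 0) :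
    ∀ i ∈ s, c i = 0 := by
  refine eq_zero_of_sum_eval₂_mul_mem (eval₂RingHom MvPolynomial.C Q) ⊥ P (fun r hr => ?_) s v
    (fun c' hc' => ?_) c (by simpa [pairHom] using h)
  · rw [Ideal.mem_bot] at hr ⊢
    exact (mul_eq_zero.mp hr).resolve_left hP0
  · rw [bot_sup_eq] at hc'
    refine eq_zero_of_sum_eval₂_mul_mem MvPolynomial.C (Ideal.span {P}) Q (fun r hr => ?_) s v
      (fun c'' hc'' => ?_) c' hc'
    · rw [Ideal.mem_span_singleton] at hr ⊢
      exact hPQ r hr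
    · refine linearIndependent_iff'.mp hv s c'' ?_
      rw [← Ideal.span_union, Set.singleton_union] at hc''
      have := Ideal.Quotient.eq_zero_iff_mem.mpr hc''
      rw [map_sum] at this
      rw [← this]
      refine Finset.sum_congr rfl fun i _ => ?_
      rw [← map_smul, MvPolynomial.smul_eq_C_mul]
      rfl

/-- Graded Nakayama: modulo the span of the monomials, a form of degree `e` is a combination of `P`
and `Q` with coefficients of degree `e - D < e`. -/
theorem mem_of_span_monomial_eq_top {P Q : MvPolynomial (Fin 2) K} {D : ℕ} (hD : 0 < D)
    (hP : P.IsHomogeneous D) (hQ : Q.IsHomogeneous D) {ι : Type*} (m : ι → Fin 2 →₀ ℕ)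
    (hspan : Submodule.span K (Set.range fun i =>
      Ideal.Quotient.mkₐ K (Ideal.span {P, Q}) (MvPolynomial.monomial (m i) 1)) = ⊤)
    (N : Submodule K (MvPolynomial (Fin 2) K)) (hNP : ∀ f ∈ N, P * f ∈ N)
    (hNQ : ∀ f ∈ N, Q * f ∈ N) (hNm : ∀ i, MvPolynomial.monomial (m i) 1 ∈ N)
    (f : MvPolynomial (Fin 2) K) : f ∈ N := by
  refine mem_of_homogeneousComponent_mem N fun e => ?_
  induction e using Nat.strong_induction_on generalizing f with
  | _ e ih =>
  have hmem : Ideal.Quotient.mkₐ K (Ideal.span {P, Q}) f ∈ Submodule.map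
      (Ideal.Quotient.mkₐ K (Ideal.span {P, Q})).toLinearMap
      (Submodule.span K (Set.range fun i => MvPolynomial.monomial (m i) (1 : K))) := by
    rw [Submodule.map_span, ← Set.range_comp]
    have := hspan ▸ Submodule.mem_top (R := K) (x := Ideal.Quotient.mkₐ K (Ideal.span {P, Q}) f)
    exact this
  obtain ⟨y, hy, hyf⟩ := hmem
  have hI : f - y ∈ Ideal.span {P, Q} := by
    rw [← Ideal.Quotient.eq_zero_iff_mem, map_sub, sub_eq_zero]
    exact hyf.symm
  obtain ⟨f₁, f₂, hf⟩ := Ideal.mem_span_pair.mp hI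
  have hf' : f = y + P * f₁ + Q * f₂ := by linear_combination -hf
  have hyN : MvPolynomial.homogeneousComponent e y ∈ N := by
    have : Submodule.span K (Set.range fun i => MvPolynomial.monomial (m i) (1 : K)) ≤
        N.comap (MvPolynomial.homogeneousComponent e) := by
      rw [Submodule.span_le]
      rintro _ ⟨i, rfl⟩
      simp only [SetLike.mem_coe, Submodule.mem_comap]
      rw [MvPolynomial.homogeneousComponent_of_mem (MvPolynomial.isHomogeneous_monomial 1 rfl)]
      split_ifs
      exacts [hNm i, N.zero_mem]
    exact this hy
  rw [hf', map_add, map_add]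
  rcases le_or_gt D e with h | h
  · rw [homogeneousComponent_mul_of_le hP _ h, homogeneousComponent_mul_of_le hQ _ h]
    exact N.add_mem (N.add_mem hyN (hNP _ (ih _ (by omega) _))) (hNQ _ (ih _ (by omega) _))
  · rw [homogeneousComponent_mul_of_lt hP _ h, homogeneousComponent_mul_of_lt hQ _ h, add_zero,
      add_zero]
    exact hyN

theorem free_pairHom {P Q : MvPolynomial (Fin 2) K} {D : ℕ} (hD : 0 < D)
    (hP : P.IsHomogeneous D) (hQ : Q.IsHomogeneous D) (hP0 : P ≠ 0)
    (hPQ : ∀ r, P ∣ Q * r → P ∣ r) :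
    letI := (pairHom P Q).toAlgebra
    Module.Free K[X][X] (MvPolynomial (Fin 2) K) := by
  let _ := (pairHom P Q).toAlgebra
  have hsm : ∀ (t : K[X][X]) (f : MvPolynomial (Fin 2) K), t • f = pairHom P Q t * f :=
    fun _ _ => rfl
  let π := Ideal.Quotient.mkₐ K (Ideal.span {P, Q})
  -- Select monomials whose classes form a `K`-basis of `R/(P, Q)`; they will be the basis over
  -- `K[P, Q]`.
  obtain ⟨κ, a, -, hsp, hli⟩ := exists_linearIndependent' K
    (fun m : Fin 2 →₀ ℕ => π (MvPolynomial.monomial m (1 : K)))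
  have htop : Submodule.span K (Set.range fun m : Fin 2 →₀ ℕ =>
      π (MvPolynomial.monomial m (1 : K))) = ⊤ := by
    have h1 : Set.range (fun m : Fin 2 →₀ ℕ => π (MvPolynomial.monomial m (1 : K))) =
        π.toLinearMap '' Set.range (MvPolynomial.basisMonomials (Fin 2) K) := by
      rw [← Set.range_comp]
      congr 1
    rw [h1, ← Submodule.map_span, Module.Basis.span_eq, Submodule.map_top, LinearMap.range_eq_top]
    exact Ideal.Quotient.mkₐ_surjective K _
  rw [htop] at hsp
  have hLI : LinearIndependent K[X][X] fun i => MvPolynomial.monomial (a i) (1 : K) := by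
    rw [linearIndependent_iff']
    intro s g hg
    exact eq_zero_of_sum_pairHom_mul hP0 hPQ _ hli s g (by simpa only [hsm] using hg)
  refine Module.Free.of_basis (Module.Basis.mk hLI ?_)
  intro f _
  let N : Submodule K (MvPolynomial (Fin 2) K) :=
    { (Submodule.span K[X][X] (Set.range fun i =>
        MvPolynomial.monomial (a i) (1 : K))).toAddSubmonoid with
      smul_mem' := fun c x hx => by
        have := Submodule.smul_mem _ (C (C c) : K[X][X]) hx
        rw [hsm, pairHom_C_C, ← MvPolynomial.smul_eq_C_mul] at this
        exact this }
  refine mem_of_span_monomial_eq_top hD hP hQ a hsp N (fun f hf => ?_) (fun f hf => ?_)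
    (fun i => ?_) f
  · have := Submodule.smul_mem _ (X : K[X][X]) hf
    rw [hsm, pairHom_X] at this
    exact this
  · have := Submodule.smul_mem _ (C X : K[X][X]) hf
    rw [hsm, pairHom_C_X] at this
    exact this
  · exact Submodule.subset_span ⟨i, rfl⟩

end Free

/-! ### Divisibility of the syzygy degrees. -/

section Degrees

variable {K : Type*} [Field K] {d : ℕ}

theorem dvd_of_exact_of_proportional {P Q : MvPolynomial (Fin 2) K} {D : ℕ} (hD : 0 < D)
    (hP : P.IsHomogeneous D) (hQ : Q.IsHomogeneous D) (hP0 : P ≠ 0)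
    (hPQ : ∀ r, P ∣ Q * r → P ∣ r) {a : Fin (d + 1) → MvPolynomial (Fin 2) K} {μ : Fin d → ℕ}
    {A : Matrix (Fin (d + 1)) (Fin d) (MvPolynomial (Fin 2) K)}
    (hA : ∀ i j, (A i j).IsHomogeneous (μ j)) (hinj : Function.Injective A.mulVecLin)
    (hex : Function.Exact A.mulVecLin (Fintype.linearCombination (MvPolynomial (Fin 2) K) a))
    {g g' : MvPolynomial (Fin 2) K} (hg : g ≠ 0) (hg' : g' ≠ 0) (b : Fin (d + 1) → K[X][X])
    (hab : ∀ i, g * a i = g' * pairHom P Q (b i)) (j : Fin d) : D ∣ μ j := by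
  classical
  by_contra hj
  let _ := (pairHom P Q).toAlgebra
  have hsm : ∀ (t : K[X][X]) (f : MvPolynomial (Fin 2) K), t • f = pairHom P Q t * f :=
    fun _ _ => rfl
  have := free_pairHom hD hP hQ hP0 hPQ
  let B := Module.Free.chooseBasis K[X][X] (MvPolynomial (Fin 2) K)
  have hsyz : ∀ c : Fin (d + 1) → MvPolynomial (Fin 2) K,
      ∑ i, c i * a i = 0 ↔ ∑ i, c i * pairHom P Q (b i) = 0 := by
    intro c
    have : g * ∑ i, c i * a i = g' * ∑ i, c i * pairHom P Q (b i) := by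
      simp only [Finset.mul_sum]
      exact Finset.sum_congr rfl fun i _ => by linear_combination c i * hab i
    constructor
    · intro h
      rw [h, mul_zero] at this
      exact (mul_eq_zero.mp this.symm).resolve_left hg'
    · intro h
      rw [h, mul_zero] at this
      exact (mul_eq_zero.mp this).resolve_left hg
  have hcol : ∑ i, A i j * a i = 0 := by
    have := hex.apply_apply_eq_zero (Pi.single j 1)
    simpa [Fintype.linearCombination_apply] using this
  have hrel : ∑ i, b i • A i j = 0 := by
    rw [← (hsyz _).mp hcol]
    exact Finset.sum_congr rfl fun i _ => by rw [hsm, mul_comm]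
  -- The relation has coefficients in `K[P, Q]`, so it holds separately for each basis coordinate;
  -- each coordinate vector is again a syzygy and so lies in the image of `A`.
  have hm : ∀ l, ∃ w : Fin d → MvPolynomial (Fin 2) K,
      A.mulVecLin w = fun i => pairHom P Q (B.repr (A i j) l) := by
    intro l
    refine (hex _).mp ?_
    rw [Fintype.linearCombination_apply]
    simp only [smul_eq_mul]
    rw [hsyz]
    have h1 := congrArg (fun f => B.repr f l) hrel
    simp only [map_sum, map_smul, map_zero, Finsupp.coe_finsetSum, Finset.sum_apply,
      Finsupp.smul_apply, smul_eq_mul, Finsupp.coe_zero, Pi.zero_apply] at h1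
    have h2 := congrArg (pairHom P Q) h1
    rw [map_sum, map_zero] at h2
    rw [← h2]
    exact Finset.sum_congr rfl fun i _ => by rw [map_mul, mul_comm]
  choose w hw using hm
  let S := Finset.univ.biUnion fun i => (B.repr (A i j)).support
  have hexp : ∀ i, A i j = ∑ l ∈ S, pairHom P Q (B.repr (A i j) l) * B l := by
    intro i
    conv_lhs => rw [← B.linearCombination_repr (A i j), Finsupp.linearCombination_apply]
    rw [Finsupp.sum_of_support_subset _
      (Finset.subset_biUnion_of_mem (fun i => (B.repr (A i j)).support) (Finset.mem_univ i)) _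
      (fun l _ => by rw [hsm, map_zero, zero_mul])]
    rfl
  -- Both sides map to column `j` under the injective `A`. Comparing constant terms in entry `j`
  -- yields an `l` for which `w l j` has nonzero constant term.
  have hone : (∑ l ∈ S, B l • w l) = Pi.single j 1 := by
    apply hinj
    rw [map_sum]
    simp only [map_smul, hw]
    ext1 i
    simp only [Finset.sum_apply, Pi.smul_apply, smul_eq_mul, Matrix.mulVecLin_apply,
      Matrix.mulVec_single_one, Matrix.col_apply]
    exact (Finset.sum_congr rfl fun l _ => mul_comm _ _).trans (hexp i).symm
  have hone' := congrArg MvPolynomial.constantCoeff (congrFun hone j)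
  rw [Finset.sum_apply, map_sum, Pi.single_eq_same, map_one] at hone'
  obtain ⟨l, -, hl⟩ := Finset.exists_ne_zero_of_sum_ne_zero
    (hone'.trans_ne one_ne_zero)
  rw [Pi.smul_apply, smul_eq_mul, map_mul] at hl
  have hl' := right_ne_zero_of_mul hl
  -- `A w'` is the degree `μ j` part of `A (w l)`, which vanishes because the entries of `A (w l)`
  -- lie in `K[P, Q]` and `D ∤ μ j`. Yet entry `j` of `w'` is the nonzero constant term just found.
  let w' : Fin d → MvPolynomial (Fin 2) K := fun i =>
    if μ i ≤ μ j then MvPolynomial.homogeneousComponent (μ j - μ i) (w l i) else 0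
  have hw' : w' = 0 := by
    apply hinj
    rw [map_zero]
    ext1 i
    have h1 := congrArg (MvPolynomial.homogeneousComponent (μ j)) (congrFun (hw l) i)
    rw [homogeneousComponent_pairHom_eq_zero hP hQ hj] at h1
    rw [Pi.zero_apply, ← h1]
    simp only [Matrix.mulVecLin_apply, Matrix.mulVec, dotProduct, map_sum]
    refine Finset.sum_congr rfl fun i' _ => ?_
    simp only [w']
    split_ifs with h
    · rw [homogeneousComponent_mul_of_le (hA i i') _ h]
    · rw [homogeneousComponent_mul_of_lt (hA i i') _ (not_le.mp h), mul_zero]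
  have h1 := congrFun hw' j
  simp only [w', le_refl, if_true, Nat.sub_self, MvPolynomial.homogeneousComponent_zero,
    Pi.zero_apply, MvPolynomial.C_eq_zero] at h1
  exact hl' h1

end Degrees

/-! ### Lüroth generators and the divisibility `D ∣ μ j`. -/

section Structure

variable {K : Type*} [Field K] {n d : ℕ}

/-- The dehomogenization `f(x, 1)` of a polynomial `f(s, t)`. -/
noncomputable def dehom (f : MvPolynomial (Fin 2) K) : K[X] := MvPolynomial.aeval ![X, 1] f

theorem aeval_cons_one {S : Type*} [CommRing S] [Algebra K S] (x : S)
    (f : MvPolynomial (Fin 2) K) : MvPolynomial.aeval ![x, 1] f = aeval x (dehom f) := by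
  rw [dehom, MvPolynomial.comp_aeval_apply]
  congr 2
  funext i
  fin_cases i <;> simp

theorem aeval_ratFunc_X (f : MvPolynomial (Fin 2) K) :
    MvPolynomial.aeval ![RatFunc.X, 1] f = algebraMap K[X] (RatFunc K) (dehom f) := by
  rw [aeval_cons_one, ← RatFunc.algebraMap_X, aeval_algebraMap_apply, aeval_X_left_apply]

theorem dehom_ne_zero {f : MvPolynomial (Fin 2) K} (hf : f.IsHomogeneous n) (h0 : f ≠ 0) :
    dehom f ≠ 0 := by
  intro h
  refine h0 (aeval_inj hf (MvPolynomial.isHomogeneous_zero _ _ _) ?_)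
  rw [map_zero]
  exact h

theorem div_mem_imageField (a : Fin (d + 1) → MvPolynomial (Fin 2) K) (i j : Fin (d + 1)) :
    algebraMap K[X] (RatFunc K) (dehom (a i)) / algebraMap K[X] (RatFunc K) (dehom (a j)) ∈
      imageField a :=
  IntermediateField.subset_adjoin _ _ ⟨i, j, by rw [aeval_ratFunc_X, aeval_ratFunc_X]⟩

theorem eq_zero_of_smul_eq_smul {M ι : Type*} [AddCommGroup M] [Module K M] {a : ι → M}
    (ha : LinearIndependent K a) {i j : ι} (hij : i ≠ j) {c c' : K} (h : c • a i = c' • a j) :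
    c = 0 := by
  have : Finsupp.single i c = Finsupp.single j c' := ha (by simpa using h)
  simpa [Finsupp.single_eq_of_ne hij] using DFunLike.congr_fun this i

theorem ne_zero_of_mem_param {a : Fin (d + 1) → MvPolynomial (Fin 2) K} (ha : a ∈ param K n d)
    (i : Fin (d + 1)) : a i ≠ 0 := ha.2.1.ne_zero i

theorem dehom_param_ne_zero {a : Fin (d + 1) → MvPolynomial (Fin 2) K} (ha : a ∈ param K n d)
    (i : Fin (d + 1)) : dehom (a i) ≠ 0 := dehom_ne_zero (ha.1 i) (ne_zero_of_mem_param ha i)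

/-- The form `∑ uⱼ vʲ wᵐ⁻ʲ` of degree `m` attached to a polynomial `u` of degree at most `m`. -/
noncomputable def binaryForm {R : Type*} [CommRing R] [Algebra K R] (u : K[X]) (m : ℕ) (v w : R) :
    R := ∑ j ∈ Finset.range (m + 1), algebraMap K R (u.coeff j) * v ^ j * w ^ (m - j)

theorem map_binaryForm {R S F : Type*} [CommRing R] [CommRing S] [Algebra K R] [Algebra K S]
    [FunLike F R S] [RingHomClass F R S] (φ : F) (hφ : ∀ c, φ (algebraMap K R c) = algebraMap K S c)
    (u : K[X]) (m : ℕ) (v w : R) : φ (binaryForm u m v w) = binaryForm u m (φ v) (φ w) := by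
  simp [binaryForm, hφ]

theorem binaryForm_div {L : Type*} [Field L] [Algebra K L] {u : K[X]} {m : ℕ}
    (hm : u.natDegree ≤ m) (v w : L) (hw : w ≠ 0) :
    binaryForm u m v w = w ^ m * aeval (v / w) u := by
  rw [aeval_eq_sum_range' (Nat.lt_succ_of_le hm), Finset.mul_sum, binaryForm]
  refine Finset.sum_congr rfl fun j hj => ?_
  have hj' : j ≤ m := Nat.lt_succ_iff.mp (Finset.mem_range.mp hj)
  rw [Algebra.smul_def, div_pow, pow_sub₀ _ hw hj']
  field_simp

theorem isHomogeneous_binaryForm {P Q : MvPolynomial (Fin 2) K} {D : ℕ} (hP : P.IsHomogeneous D)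
    (hQ : Q.IsHomogeneous D) (u : K[X]) (m : ℕ) : (binaryForm u m P Q).IsHomogeneous (D * m) := by
  refine MvPolynomial.IsHomogeneous.sum _ _ _ fun j hj => ?_
  have hj' : j ≤ m := Nat.lt_succ_iff.mp (Finset.mem_range.mp hj)
  have := ((hP.pow j).C_mul (u.coeff j)).mul (hQ.pow (m - j))
  rwa [← mul_add, Nat.add_sub_cancel' hj'] at this

theorem exists_common_denominator {L : Type*} [Field L] [Algebra K L] {h : L} {ι : Type*}
    [Fintype ι] (f : ι → L) (hf : ∀ i, f i ∈ IntermediateField.adjoin K {h}) :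
    ∃ (V : K[X]) (U : ι → K[X]), aeval h V ≠ 0 ∧ ∀ i, aeval h V * f i = aeval h (U i) := by
  classical
  have : ∀ i, ∃ r s : K[X], aeval h s ≠ 0 ∧ aeval h s * f i = aeval h r := by
    intro i
    obtain ⟨r, s, hrs⟩ := (IntermediateField.mem_adjoin_simple_iff K _).mp (hf i)
    -- With a vanishing denominator, `f i = r / 0 = 0`, so the fraction `0 / 1` serves.
    by_cases hs : aeval h s = 0
    · exact ⟨0, 1, by simp, by simp [hrs, hs]⟩
    · exact ⟨r, s, hs, by rw [hrs]; field_simp⟩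
  choose r s hs hrs using this
  refine ⟨∏ i, s i, fun i => r i * ∏ j ∈ Finset.univ.erase i, s j, ?_, fun i => ?_⟩
  · rw [map_prod]
    exact Finset.prod_ne_zero_iff.mpr fun i _ => hs i
  · rw [← Finset.mul_prod_erase _ _ (Finset.mem_univ i), map_mul, map_mul, ← hrs i]
    ring

theorem max_natDegree_pos {h : RatFunc K} (hh : ¬ ∃ c, h = RatFunc.C c) :
    0 < max h.num.natDegree h.denom.natDegree := by
  rw [Nat.pos_iff_ne_zero, ne_eq, Nat.max_eq_zero_iff, ← RatFunc.eq_C_iff]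
  exact hh

/-- Writing `a i / a 0 = U i (h) / V (h)` and clearing powers of `q` turns `V` and `U i` into forms
of one degree `m` in `P, Q`, with `V(P, Q) * a i = a 0 * U i (P, Q)`. This is the proportionality
needed to transfer syzygies. -/
theorem dvd_muType_of_imageField_eq {μ : Fin d → ℕ} {a : Fin (d + 1) → MvPolynomial (Fin 2) K}
    (ha : a ∈ stratum K n d μ) {h : RatFunc K} (hh : ¬ ∃ c, h = RatFunc.C c)
    (hE : imageField a = IntermediateField.adjoin K {h}) (j : Fin d) :
    max h.num.natDegree h.denom.natDegree ∣ μ j := by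
  obtain ⟨hap, -, -, A, hA, hinj, hex⟩ := ha
  set p := h.num
  set q := h.denom
  set D := max p.natDegree q.natDegree
  have hp0 : p ≠ 0 := RatFunc.num_ne_zero (by rintro rfl; exact hh ⟨0, by simp⟩)
  have hq0 : q ≠ 0 := h.denom_ne_zero
  have hpD : p.natDegree ≤ D := le_max_left _ _
  have hqD : q.natDegree ≤ D := le_max_right _ _
  set P := p.homogenize D
  set Q := q.homogenize D
  have hP : P.IsHomogeneous D := isHomogeneous_homogenize p
  have hQ : Q.IsHomogeneous D := isHomogeneous_homogenize q
  let α : Fin (d + 1) → RatFunc K := fun i => algebraMap K[X] (RatFunc K) (dehom (a i))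
  have hα : ∀ i, α i ≠ 0 := fun i => RatFunc.algebraMap_ne_zero (dehom_param_ne_zero hap i)
  obtain ⟨V, U, hV, hU⟩ := exists_common_denominator (h := h) (fun i => α i / α 0)
    (fun i => hE ▸ div_mem_imageField a i 0)
  obtain ⟨m, hVm, hUm⟩ : ∃ m, V.natDegree ≤ m ∧ ∀ i, (U i).natDegree ≤ m :=
    ⟨V.natDegree + ∑ i, (U i).natDegree, by omega, fun i => le_add_left
      (Finset.single_le_sum (f := fun i => (U i).natDegree) (by simp) (Finset.mem_univ i))⟩
  have hqα : algebraMap K[X] (RatFunc K) q ≠ 0 := RatFunc.algebraMap_ne_zero hq0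
  have hform : ∀ u : K[X], u.natDegree ≤ m →
      algebraMap K[X] (RatFunc K) (dehom (binaryForm u m P Q)) =
        (algebraMap K[X] (RatFunc K) q) ^ m * aeval h u := by
    intro u hu
    rw [dehom, map_binaryForm _ (fun c => by simp [MvPolynomial.algebraMap_eq]),
      aeval_homogenize_X_one _ hpD, aeval_homogenize_X_one _ hqD,
      map_binaryForm (algebraMap K[X] (RatFunc K))
        (fun c => (IsScalarTower.algebraMap_apply K K[X] (RatFunc K) c).symm),
      binaryForm_div hu _ _ hqα, RatFunc.num_div_denom]
  have hpair : ∀ u : K[X], pairHom P Q (binaryForm u m X (C X)) = binaryForm u m P Q := by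
    intro u
    rw [map_binaryForm (pairHom P Q) (fun c => pairHom_C_C P Q c), pairHom_X, pairHom_C_X]
  refine dvd_of_exact_of_proportional (max_natDegree_pos hh) hP hQ (homogenize_ne_zero hp0 hpD)
    (fun r => homogenize_dvd_of_dvd_mul h.isCoprime_num_denom hp0 hq0 rfl) hA hinj hex
    (g := binaryForm V m P Q) (g' := a 0) ?_ (ne_zero_of_mem_param hap 0)
    (fun i => binaryForm (U i) m X (C X)) (fun i => ?_) j
  · intro h0
    have := hform V hVm
    rw [h0] at this
    simp only [dehom, map_zero] at this
    exact mul_ne_zero (pow_ne_zero _ hqα) hV this.symm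
  · rw [hpair]
    refine aeval_inj (n := D * m + n) ((isHomogeneous_binaryForm hP hQ V m).mul (hap.1 i)) ?_ ?_
    · rw [add_comm (D * m) n]
      exact (hap.1 0).mul (isHomogeneous_binaryForm hP hQ (U i) m)
    · apply RatFunc.algebraMap_injective K
      change algebraMap K[X] (RatFunc K) (dehom _) = algebraMap K[X] (RatFunc K) (dehom _)
      have e1 : ∀ f g : MvPolynomial (Fin 2) K, dehom (f * g) = dehom f * dehom g :=
        fun f g => map_mul _ f g
      rw [e1, e1, map_mul, map_mul, hform V hVm, hform (U i) (hUm i), ← hU i]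
      have := hα 0
      change _ * α i = α 0 * _
      field_simp

theorem imageField_ne_bot (hd : 1 ≤ d) {a : Fin (d + 1) → MvPolynomial (Fin 2) K}
    (ha : a ∈ param K n d) : imageField a ≠ ⊥ := by
  intro h
  let i : Fin (d + 1) := ⟨1, by omega⟩
  have hi : i ≠ 0 := by simp [i, Fin.ext_iff]
  have h1 := h ▸ div_mem_imageField a i 0
  obtain ⟨c, hc⟩ := IntermediateField.mem_bot.mp h1
  rw [eq_div_iff (RatFunc.algebraMap_ne_zero (dehom_param_ne_zero ha 0)),
    IsScalarTower.algebraMap_apply K K[X] (RatFunc K), ← map_mul] at hc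
  have h2 := RatFunc.algebraMap_injective K hc
  have h3 : c • a 0 = a i := by
    refine aeval_inj (n := n) ?_ (ha.1 i) ?_
    · rw [MvPolynomial.smul_eq_C_mul]; exact (ha.1 0).C_mul c
    · rw [map_smul, Algebra.smul_def]; exact h2
  exact one_ne_zero (eq_zero_of_smul_eq_smul ha.2.1 hi ((one_smul K _).trans h3.symm))

end Structure
-- Fibres of a rational function over an algebraically closed field.
section Cross

variable {K L : Type*} [Field K] [Field L] [Algebra K L]

/-- The points `x` and `y` have the same image under the rational function `p / q`. -/
def Cross (p q : K[X]) (x y : L) : Prop := aeval x p * aeval y q = aeval y p * aeval x q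

theorem finite_zeros {u : K[X]} (hu : u ≠ 0) : {x : L | aeval x u = 0}.Finite := by
  refine (u.rootSet_finite L).subset fun x hx => ?_
  rw [mem_rootSet]
  exact ⟨hu, hx⟩

theorem not_both_zero {p q : K[X]} (hpq : IsCoprime p q) (x : L) :
    aeval x p ≠ 0 ∨ aeval x q ≠ 0 := by
  by_contra! h
  obtain ⟨u, v, huv⟩ := hpq
  have := congrArg (aeval x) huv
  simp [h.1, h.2] at this

theorem combination_ne_zero {p q : K[X]} (hpq : IsCoprime p q)
    (hD : 0 < max p.natDegree q.natDegree) {α β : K} (h : α ≠ 0 ∨ β ≠ 0) :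
    C α * q - C β * p ≠ 0 := by
  intro h0
  have h1 : C α * q = C β * p := sub_eq_zero.mp h0
  have key : p.natDegree = 0 ∧ q.natDegree = 0 := by
    rcases h with h | h
    · have h2 : q = C (α⁻¹ * β) * p := by
        rw [C_mul, mul_assoc, ← h1, ← mul_assoc, ← C_mul, inv_mul_cancel₀ h, C_1, one_mul]
      have hp := natDegree_eq_zero_of_isUnit (hpq.isUnit_of_dvd' dvd_rfl (h2 ▸ dvd_mul_left _ _))
      have := natDegree_C_mul_le (α⁻¹ * β) p
      rw [← h2] at this
      exact ⟨hp, by omega⟩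
    · have h2 : p = C (β⁻¹ * α) * q := by
        rw [C_mul, mul_assoc, h1, ← mul_assoc, ← C_mul, inv_mul_cancel₀ h, C_1, one_mul]
      have hq := natDegree_eq_zero_of_isUnit (hpq.isUnit_of_dvd' (h2 ▸ dvd_mul_left _ _) dvd_rfl)
      have := natDegree_C_mul_le (β⁻¹ * α) q
      rw [← h2] at this
      exact ⟨by omega, hq⟩
  rw [key.1, key.2] at hD
  exact lt_irrefl _ hD

theorem combination_map_ne_zero {p q : K[X]} (hpq : IsCoprime p q)
    (hD : 0 < max p.natDegree q.natDegree) {α β : L} (h : α ≠ 0 ∨ β ≠ 0) :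
    C α * q.map (algebraMap K L) - C β * p.map (algebraMap K L) ≠ 0 :=
  combination_ne_zero (hpq.map (mapRingHom (algebraMap K L)))
    (by simpa only [coe_mapRingHom, natDegree_map] using hD) h

theorem finite_cross {p q : K[X]} (hpq : IsCoprime p q)
    (hD : 0 < max p.natDegree q.natDegree) {Z : Set L} (hZ : Z.Finite) :
    {y : L | ∃ x ∈ Z, Cross p q x y}.Finite := by
  have : {y : L | ∃ x ∈ Z, Cross p q x y} = ⋃ x ∈ Z, {y | Cross p q x y} := by
    ext; simp
  rw [this]
  refine hZ.biUnion fun x _ => ?_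
  refine (finite_zeros (K := L) (combination_map_ne_zero hpq hD
    (not_both_zero hpq x))).subset fun y hy => ?_
  have hy' : aeval x p * aeval y q = aeval y p * aeval x q := hy
  simp only [Set.mem_ofPred_eq, map_sub, map_mul, aeval_C, aeval_map_algebraMap, hy',
    Algebra.algebraMap_self, RingHom.id_apply]
  ring

/-- The fibre through `y` is the root set of `q(y) p - p(y) q`. This has degree `D` unless `y`
shares its value with infinity, and has simple roots unless the fibre meets a zero of the Wronskian.
-/
theorem finite_encard_cross_of_separable [IsAlgClosed L] {p q : K[X]} (hpq : IsCoprime p q)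
    (hD : 0 < max p.natDegree q.natDegree) (hw : derivative p * q - p * derivative q ≠ 0) :
    ∃ B : Set L, B.Finite ∧ ∀ y ∉ B,
      {x : L | Cross p q x y}.encard = (max p.natDegree q.natDegree : ℕ) := by
  classical
  set D := max p.natDegree q.natDegree
  have hlead : C (p.coeff D) * q - C (q.coeff D) * p ≠ 0 := by
    apply combination_ne_zero hpq hD
    rcases le_total p.natDegree q.natDegree with h | h
    · right
      have hq : q ≠ 0 := by
        rintro rfl
        simp only [natDegree_zero, nonpos_iff_eq_zero] at h
        simp [D, h] at hD
      simpa [D, h] using hq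
    · left
      have hp : p ≠ 0 := by
        rintro rfl
        simp only [natDegree_zero, nonpos_iff_eq_zero] at h
        simp [D, h] at hD
      simpa [D, h] using hp
  refine ⟨{y | aeval y (C (p.coeff D) * q - C (q.coeff D) * p) = 0} ∪
    {y | ∃ x ∈ {x : L | aeval x (derivative p * q - p * derivative q) = 0}, Cross p q x y},
    (finite_zeros hlead).union (finite_cross hpq hD (finite_zeros hw)), fun y hy => ?_⟩
  simp only [Set.mem_union, Set.mem_ofPred_eq, not_or, not_exists, not_and] at hy
  obtain ⟨hy1, hy2⟩ := hy
  let g : L[X] := C (aeval y q) * p.map (algebraMap K L) - C (aeval y p) * q.map (algebraMap K L)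
  have hgx : ∀ x, g.eval x = aeval y q * aeval x p - aeval y p * aeval x q := by
    intro x
    simp [g, aeval_def, eval_map]
  have hgD : g.coeff D ≠ 0 := by
    simp only [map_sub, map_mul, aeval_C] at hy1
    simp only [g, coeff_sub, coeff_C_mul, coeff_map]
    intro h
    exact hy1 (by linear_combination h)
  have hg0 : g ≠ 0 := fun h => hgD (by rw [h, coeff_zero])
  have hdeg : g.natDegree = D := by
    refine le_antisymm ((natDegree_sub_le _ _).trans (max_le ?_ ?_)) (le_natDegree_of_ne_zero hgD)
    · exact (natDegree_C_mul_le _ _).trans ((natDegree_map_le).trans (le_max_left _ _))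
    · exact (natDegree_C_mul_le _ _).trans ((natDegree_map_le).trans (le_max_right _ _))
  have hnodup : g.roots.Nodup := by
    rw [Multiset.nodup_iff_count_le_one]
    intro x
    by_contra hx
    rw [not_le, count_roots, one_lt_rootMultiplicity_iff_isRoot hg0] at hx
    obtain ⟨h1, h2⟩ := hx
    rw [IsRoot, hgx] at h1
    have h2' : aeval y q * aeval x (derivative p) - aeval y p * aeval x (derivative q) = 0 := by
      have : (derivative g).eval x = _ := h2
      simpa [g, aeval_def, eval_map, derivative_map] using this
    refine hy2 x ?_ (by simp only [Cross]; linear_combination h1)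
    simp only [map_sub, map_mul]
    -- A double root gives two linear equations in the nonzero vector `(p(y), q(y))`; their
    -- determinant, the Wronskian at `x`, must vanish.
    rcases not_both_zero (L := L) hpq y with h | h
    · apply mul_left_cancel₀ h
      linear_combination aeval x p * h2' - aeval x (derivative p) * h1
    · apply mul_left_cancel₀ h
      linear_combination aeval x q * h2' - aeval x (derivative q) * h1
  have hset : {x : L | Cross p q x y} = (g.roots.toFinset : Set L) := by
    ext x
    simp only [Set.mem_ofPred_eq, Finset.mem_coe, Multiset.mem_toFinset, mem_roots hg0, IsRoot, hgx,
      Cross]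
    constructor <;> intro h <;> linear_combination h
  rw [hset, Set.encard_coe_eq_coe_finsetCard, Multiset.toFinset_card_of_nodup hnodup,
    ← (IsAlgClosed.splits g).natDegree_eq_card_roots, hdeg]

/-- Coprimality makes `p` divide its own derivative, which would have smaller degree. -/
theorem derivative_eq_zero_of_isCoprime {p q : K[X]} (hpq : IsCoprime p q)
    (h : derivative p * q = p * derivative q) : derivative p = 0 := by
  have h1 : p ∣ derivative p := hpq.dvd_of_dvd_mul_right ⟨_, h⟩
  by_contra h0
  have hp : 0 < p.natDegree := by
    rw [Nat.pos_iff_ne_zero]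
    intro h2
    exact h0 (derivative_of_natDegree_zero h2)
  exact absurd (natDegree_le_of_dvd h1 h0) (not_le.mpr (natDegree_derivative_lt hp.ne'))

/-- Here `s` plays the role of the separable degree. If the Wronskian vanishes then both derivatives
do, so `p` and `q` are polynomials in `X ^ ℓ`; since Frobenius is bijective on `L`, contracting them
divides `D` by `ℓ` and preserves fibre sizes. -/
theorem exists_encard_cross [IsAlgClosed L] {p q : K[X]} (hpq : IsCoprime p q)
    (hD : 0 < max p.natDegree q.natDegree) :
    ∃ (s : ℕ) (B : Set L), B.Finite ∧ s ∣ max p.natDegree q.natDegree ∧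
      ((derivative p ≠ 0 ∨ derivative q ≠ 0) → s = max p.natDegree q.natDegree) ∧
      ∀ y ∉ B, {x : L | Cross p q x y}.encard = s := by
  induction hN : max p.natDegree q.natDegree using Nat.strong_induction_on generalizing p q with
  | _ N ih =>
  by_cases hw : derivative p * q - p * derivative q = 0
  · have hp' := derivative_eq_zero_of_isCoprime hpq (sub_eq_zero.mp hw)
    have hq' := derivative_eq_zero_of_isCoprime hpq.symm
      (by linear_combination -(sub_eq_zero.mp hw))
    obtain ⟨ℓ, hchar⟩ := CharP.exists K
    rcases CharP.char_is_prime_or_zero K ℓ with hℓ | rfl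
    · have := Fact.mk hℓ
      have : CharP L ℓ := charP_of_injective_algebraMap (algebraMap K L).injective ℓ
      set p₁ := contract ℓ p
      set q₁ := contract ℓ q
      have hp : expand K ℓ p₁ = p := expand_contract ℓ hp' hℓ.ne_zero
      have hq : expand K ℓ q₁ = q := expand_contract ℓ hq' hℓ.ne_zero
      have hdeg : max p.natDegree q.natDegree = max p₁.natDegree q₁.natDegree * ℓ := by
        rw [← hp, ← hq, natDegree_expand, natDegree_expand, max_mul_of_nonneg _ _ (Nat.zero_le _)]
      have hpos : 0 < max p₁.natDegree q₁.natDegree := by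
        rw [hdeg] at hD
        exact Nat.pos_of_mul_pos_right hD
      have hcop : IsCoprime p₁ q₁ := by
        rw [← hp, ← hq, isCoprime_expand hℓ.ne_zero] at hpq
        exact hpq
      obtain ⟨s, B, hB, hs, -, hcard⟩ := ih _ (by
        rw [← hN, hdeg]
        exact lt_mul_of_one_lt_right hpos hℓ.one_lt) hcop hpos rfl
      have hbij : Function.Bijective (fun x : L => x ^ ℓ) := PerfectRing.bijective_frobenius (p := ℓ)
      refine ⟨s, (fun x : L => x ^ ℓ) ⁻¹' B, hB.preimage hbij.1.injOn, ?_, ?_, fun y hy => ?_⟩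
      · rw [← hN, hdeg]
        exact hs.mul_right _
      · rintro (h | h)
        exacts [(h hp').elim, (h hq').elim]
      · refine Eq.trans ?_ ((Set.encard_preimage_of_injective_subset_range hbij.1
          (by rw [hbij.2.range_eq]; exact Set.subset_univ _)).trans (hcard (y ^ ℓ) hy))
        congr 1
        ext x
        simp only [Set.mem_ofPred_eq, Set.mem_preimage, Cross, ← hp, ← hq, expand_aeval]
    · have := CharP.charP_to_charZero K
      rw [derivative_eq_zero.mp hp', derivative_eq_zero.mp hq'] at hD
      exact absurd hD (lt_irrefl _)
  · obtain ⟨B, hB, hcard⟩ := finite_encard_cross_of_separable (L := L) hpq hD hw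
    exact ⟨N, B, hB, dvd_rfl, fun _ => rfl, fun y hy => by rw [hcard y hy, hN]⟩

end Cross

/-! ### Functions constant on the classes of a relation. -/

section FiberConstant

variable {K L : Type*} [Field K] [Field L] [Algebra K L]

/-- The rational function `f` takes equal values at related points, away from a finite set. -/
def FiberConstant (rel : L → L → Prop) (f : RatFunc K) : Prop :=
  ∃ u v : K[X], v ≠ 0 ∧ algebraMap K[X] (RatFunc K) v * f = algebraMap K[X] (RatFunc K) u ∧
    ∃ B : Set L, B.Finite ∧ ∀ y ∉ B, ∀ x, rel x y →
      aeval x v ≠ 0 ∧ aeval y v ≠ 0 ∧ aeval x u * aeval y v = aeval y u * aeval x v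

/-- Being constant on fibres passes from generators to the whole field. Inversion costs only the
finitely many zeros of the numerator at `y`; those at `x` then follow by constancy. -/
theorem fiberConstant_of_mem_adjoin (rel : L → L → Prop) {s : Set (RatFunc K)}
    (hs : ∀ f ∈ s, FiberConstant rel f) {f : RatFunc K}
    (hf : f ∈ IntermediateField.adjoin K s) : FiberConstant rel f := by
  induction hf using IntermediateField.adjoin_induction with
  | mem f hf => exact hs f hf
  | algebraMap c =>
    refine ⟨C c, 1, one_ne_zero, ?_, ∅, Set.finite_empty, fun y _ x _ => by simp⟩
    rw [map_one, one_mul, ← algebraMap_eq, ← IsScalarTower.algebraMap_apply]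
  | add f g _ _ hf hg =>
    obtain ⟨u₁, v₁, hv₁, hf, B₁, hB₁, h₁⟩ := hf
    obtain ⟨u₂, v₂, hv₂, hg, B₂, hB₂, h₂⟩ := hg
    refine ⟨u₁ * v₂ + u₂ * v₁, v₁ * v₂, mul_ne_zero hv₁ hv₂, ?_, B₁ ∪ B₂, hB₁.union hB₂,
      fun y hy x hxy => ?_⟩
    · simp only [map_add, map_mul, ← hf, ← hg]
      ring
    · rw [Set.mem_union, not_or] at hy
      obtain ⟨a₁, b₁, e₁⟩ := h₁ y hy.1 x hxy
      obtain ⟨a₂, b₂, e₂⟩ := h₂ y hy.2 x hxy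
      simp only [map_add, map_mul]
      refine ⟨mul_ne_zero a₁ a₂, mul_ne_zero b₁ b₂, ?_⟩
      linear_combination aeval x v₂ * aeval y v₂ * e₁ + aeval x v₁ * aeval y v₁ * e₂
  | inv f _ hf =>
    obtain ⟨u, v, hv, hf, B, hB, h⟩ := hf
    by_cases hf0 : f = 0
    · exact ⟨u, v, hv, by rw [hf0, inv_zero, ← hf, hf0], B, hB, h⟩
    have hu : u ≠ 0 := by
      rintro rfl
      rw [map_zero] at hf
      exact mul_ne_zero (RatFunc.algebraMap_ne_zero hv) hf0 hf
    refine ⟨v, u, hu, by rw [← hf]; field_simp, B ∪ {y | aeval y u = 0}, hB.union (finite_zeros hu),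
      fun y hy x hxy => ?_⟩
    rw [Set.mem_union, not_or] at hy
    obtain ⟨a₁, b₁, e₁⟩ := h y hy.1 x hxy
    have hy2 : aeval y u ≠ 0 := hy.2
    refine ⟨fun hx => ?_, hy2, by linear_combination -e₁⟩
    rw [hx, zero_mul] at e₁
    exact mul_ne_zero hy2 a₁ e₁.symm
  | mul f g _ _ hf hg =>
    obtain ⟨u₁, v₁, hv₁, hf, B₁, hB₁, h₁⟩ := hf
    obtain ⟨u₂, v₂, hv₂, hg, B₂, hB₂, h₂⟩ := hg
    refine ⟨u₁ * u₂, v₁ * v₂, mul_ne_zero hv₁ hv₂, ?_, B₁ ∪ B₂, hB₁.union hB₂,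
      fun y hy x hxy => ?_⟩
    · simp only [map_mul, ← hf, ← hg]
      ring
    · rw [Set.mem_union, not_or] at hy
      obtain ⟨a₁, b₁, e₁⟩ := h₁ y hy.1 x hxy
      obtain ⟨a₂, b₂, e₂⟩ := h₂ y hy.2 x hxy
      simp only [map_mul]
      refine ⟨mul_ne_zero a₁ a₂, mul_ne_zero b₁ b₂, ?_⟩
      linear_combination aeval x u₂ * aeval y v₂ * e₁ + aeval y u₁ * aeval x v₁ * e₂

end FiberConstant

/-! ### Comparing fibres of the parametrization with fibres of `h`. -/

section Proportional

variable {K L : Type*} [Field K] [Field L] [Algebra K L] {n d : ℕ}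

/-- The vectors `(a_i(x, 1))_i` and `(a_i(y, 1))_i` differ by a non-zero scalar. -/
def Proportional (a : Fin (d + 1) → MvPolynomial (Fin 2) K) (x y : L) : Prop :=
  ∃ c : L, c ≠ 0 ∧ ∀ i, aeval x (dehom (a i)) = c * aeval y (dehom (a i))

/-- The equality of fields is used in both directions: `h` is rational in the ratios of the `a i`,
hence constant on fibres of the parametrization, and each `a i / a 0` is rational in `h`. -/
theorem exists_finite_proportional_iff_cross {a : Fin (d + 1) → MvPolynomial (Fin 2) K}
    (ha : a ∈ param K n d) {h : RatFunc K} (hh : ¬ ∃ c, h = RatFunc.C c)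
    (hE : imageField a = IntermediateField.adjoin K {h}) :
    ∃ B : Set L, B.Finite ∧ ∀ y ∉ B, ∀ x, Proportional a x y ↔ Cross h.num h.denom x y := by
  have hpq := h.isCoprime_num_denom
  have hD := max_natDegree_pos hh
  have hq0 := h.denom_ne_zero
  have hqh : algebraMap K[X] (RatFunc K) h.denom * h = algebraMap K[X] (RatFunc K) h.num := by
    nth_rewrite 2 [← RatFunc.num_div_denom h]
    rw [mul_div_cancel₀ _ (RatFunc.algebraMap_ne_zero hq0)]
  have hα0 := dehom_param_ne_zero ha 0
  have hprop : FiberConstant (Proportional (L := L) a) h := by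
    refine fiberConstant_of_mem_adjoin (s := {f | ∃ i j, f = MvPolynomial.aeval ![RatFunc.X, 1]
      (a i) / MvPolynomial.aeval ![RatFunc.X, 1] (a j)}) _ ?_ (hE ▸
      IntermediateField.mem_adjoin_simple_self K h : h ∈ imageField a)
    rintro _ ⟨i, j, rfl⟩
    have hj := dehom_param_ne_zero ha j
    refine ⟨dehom (a i), dehom (a j), hj, ?_, {y | aeval y (dehom (a j)) = 0}, finite_zeros hj, ?_⟩
    · rw [aeval_ratFunc_X, aeval_ratFunc_X, mul_div_cancel₀ _ (RatFunc.algebraMap_ne_zero hj)]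
    · rintro y hy x ⟨c, hc, hxy⟩
      rw [hxy i, hxy j]
      exact ⟨mul_ne_zero hc hy, hy, by ring⟩
  have hcross : ∀ i, FiberConstant (Cross (L := L) h.num h.denom)
      (algebraMap K[X] (RatFunc K) (dehom (a i)) / algebraMap K[X] (RatFunc K) (dehom (a 0))) := by
    intro i
    refine fiberConstant_of_mem_adjoin (s := {h}) _ ?_ (hE ▸ div_mem_imageField a i 0)
    rintro _ rfl
    refine ⟨_, _, hq0, hqh, {y | aeval y (RatFunc.denom _) = 0}, finite_zeros hq0,
      fun y hy x hxy => ⟨fun hx => ?_, hy, hxy⟩⟩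
    rw [Cross, hx, mul_zero] at hxy
    exact (not_both_zero hpq x).elim (fun h' => mul_ne_zero h' hy hxy) (fun h' => h' hx)
  obtain ⟨u, v, hv, huv, B, hB, hBh⟩ := hprop
  choose U V hV hUV B' hB' hBh' using hcross
  refine ⟨B ∪ (⋃ i, B' i) ∪ {y | aeval y (dehom (a 0)) = 0} ∪
    {y | ∃ x ∈ {x : L | aeval x (dehom (a 0)) = 0}, Cross h.num h.denom x y},
    ((hB.union (Set.finite_iUnion hB')).union (finite_zeros hα0)).union
      (finite_cross hpq hD (finite_zeros hα0)), fun y hy x => ?_⟩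
  simp only [Set.mem_union, Set.mem_iUnion, Set.mem_ofPred_eq, not_or, not_exists, not_and] at hy
  obtain ⟨⟨⟨hy1, hy2⟩, hy3⟩, hy4⟩ := hy
  constructor
  · intro hxy
    obtain ⟨e1, e2, e3⟩ := hBh y hy1 x hxy
    have huv' : h.num * v = u * h.denom := by
      apply RatFunc.algebraMap_injective K
      rw [map_mul, map_mul, ← huv, ← hqh]
      ring
    have hx := congrArg (aeval x) huv'
    have hy := congrArg (aeval y) huv'
    simp only [map_mul] at hx hy
    apply mul_left_cancel₀ (mul_ne_zero e1 e2)
    linear_combination aeval y h.denom * aeval y v * hx + aeval y h.denom * aeval x h.denom * e3 -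
      aeval x v * aeval x h.denom * hy
  · intro hxy
    have hx0 : aeval x (dehom (a 0)) ≠ 0 := fun h0 => hy4 x h0 hxy
    refine ⟨aeval x (dehom (a 0)) / aeval y (dehom (a 0)), div_ne_zero hx0 hy3, fun i => ?_⟩
    obtain ⟨e1, e2, e3⟩ := hBh' i y (hy2 i) x hxy
    have hi : dehom (a i) * V i = U i * dehom (a 0) := by
      apply RatFunc.algebraMap_injective K
      have := RatFunc.algebraMap_ne_zero hα0
      rw [map_mul, map_mul, ← hUV i]
      field_simp
    have hx := congrArg (aeval x) hi
    have hy := congrArg (aeval y) hi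
    simp only [map_mul] at hx hy
    rw [div_mul_eq_mul_div, eq_div_iff hy3]
    apply mul_left_cancel₀ (mul_ne_zero e1 e2)
    linear_combination aeval y (dehom (a 0)) * aeval y (V i) * hx +
      aeval x (dehom (a 0)) * aeval y (dehom (a 0)) * e3 -
      aeval x (V i) * aeval x (dehom (a 0)) * hy

end Proportional

open scoped LinearAlgebra.Projectivization

/-! ### Generic degree on projective points. -/

section Projective

variable {K : Type*} [Field K] {n d : ℕ}

theorem aeval_smul_of_isHomogeneous {L : Type*} [CommRing L] [Algebra K L]
    {f : MvPolynomial (Fin 2) K}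
    (hf : f.IsHomogeneous n) (c : L) (v : Fin 2 → L) :
    MvPolynomial.aeval (c • v) f = c ^ n * MvPolynomial.aeval v f := by
  rw [MvPolynomial.aeval_def, MvPolynomial.aeval_def, MvPolynomial.eval₂_eq',
    MvPolynomial.eval₂_eq', Finset.mul_sum]
  refine Finset.sum_congr rfl fun m hm => ?_
  have hm' : m.degree = n := by
    by_contra h
    exact (MvPolynomial.mem_support_iff.mp hm) (hf.coeff_eq_zero h)
  rw [Finsupp.degree_eq_sum] at hm'
  simp only [Pi.smul_apply, smul_eq_mul, mul_pow, Finset.prod_mul_distrib,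
    Finset.prod_pow_eq_pow_sum, hm']
  ring

local notation "Kbar" => AlgebraicClosure K

theorem mapsTo_mk {a : Fin (d + 1) → MvPolynomial (Fin 2) K} (ha : ∀ i, (a i).IsHomogeneous n)
    {v : Fin 2 → Kbar} (hv : v ≠ 0) (Q : ℙ Kbar (Fin (d + 1) → Kbar)) :
    MapsTo a (Projectivization.mk Kbar v hv) Q ↔
      ∃ h : (fun i => MvPolynomial.aeval v (a i)) ≠ 0, Projectivization.mk Kbar _ h = Q := by
  obtain ⟨c, hc⟩ := Projectivization.exists_smul_eq_mk_rep Kbar v hv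
  have key : (fun i => MvPolynomial.aeval (Projectivization.mk Kbar v hv).rep (a i)) =
      (c ^ n) • (fun i => MvPolynomial.aeval v (a i)) := by
    funext i
    rw [← hc, Units.smul_def, aeval_smul_of_isHomogeneous (ha i)]
    rfl
  unfold MapsTo
  simp only [key]
  constructor
  · rintro ⟨h, rfl⟩
    refine ⟨fun h0 => h (by rw [h0, smul_zero]), ?_⟩
    rw [Projectivization.mk_eq_mk_iff]
    exact ⟨(c ^ n)⁻¹, by rw [inv_smul_smul]⟩
  · rintro ⟨h, rfl⟩
    refine ⟨fun h0 => h ?_, ?_⟩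
    · rwa [smul_eq_zero_iff_eq] at h0
    · rw [Projectivization.mk_eq_mk_iff]
      exact ⟨c ^ n, rfl⟩

theorem mapsTo_unique {a : Fin (d + 1) → MvPolynomial (Fin 2) K} {P : ℙ Kbar (Fin 2 → Kbar)}
    {Q Q' : ℙ Kbar (Fin (d + 1) → Kbar)} (h : MapsTo a P Q) (h' : MapsTo a P Q') : Q = Q' := by
  obtain ⟨_, rfl⟩ := h
  obtain ⟨_, rfl⟩ := h'
  rfl

variable (K) in
/-- The point `(x : 1)` of the projective line. -/
noncomputable def affinePoint (x : Kbar) : ℙ Kbar (Fin 2 → Kbar) :=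
  Projectivization.mk Kbar ![x, 1] fun h => one_ne_zero (congrFun h 1)

variable (K) in
/-- The point `(1 : 0)` of the projective line. -/
noncomputable def infinityPoint : ℙ Kbar (Fin 2 → Kbar) :=
  Projectivization.mk Kbar ![1, 0] fun h => one_ne_zero (congrFun h 0)

theorem affinePoint_injective : Function.Injective (affinePoint K) := by
  intro x y h
  obtain ⟨c, hc⟩ := (Projectivization.mk_eq_mk_iff' _ _ _ _ _).mp h
  have h0 := congrFun hc 0
  have h1 := congrFun hc 1
  simp only [Pi.smul_apply, Matrix.cons_val_zero, Matrix.cons_val_one, smul_eq_mul] at h0 h1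
  rw [mul_one] at h1
  rw [← h0, h1, one_mul]

theorem eq_infinityPoint_or_affinePoint (P : ℙ Kbar (Fin 2 → Kbar)) :
    P = infinityPoint K ∨ ∃ x, P = affinePoint K x := by
  induction P using Projectivization.ind with
  | h v hv =>
  by_cases h1 : v 1 = 0
  · left
    refine (Projectivization.mk_eq_mk_iff' _ _ _ _ _).mpr ⟨v 0, ?_⟩
    funext i
    fin_cases i <;> simp [h1]
  · right
    refine ⟨v 0 / v 1, (Projectivization.mk_eq_mk_iff' _ _ _ _ _).mpr ⟨v 1, ?_⟩⟩
    funext i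
    fin_cases i
    · simp [mul_div_cancel₀ _ h1]
    · simp

theorem mapsTo_affinePoint_iff {a : Fin (d + 1) → MvPolynomial (Fin 2) K}
    (ha : ∀ i, (a i).IsHomogeneous n) {y : Kbar} {Q : ℙ Kbar (Fin (d + 1) → Kbar)}
    (hy : MapsTo a (affinePoint K y) Q) (x : Kbar) :
    MapsTo a (affinePoint K x) Q ↔ Proportional a x y := by
  obtain ⟨hy0, rfl⟩ := (mapsTo_mk ha _ Q).mp hy
  rw [affinePoint, mapsTo_mk ha]
  simp only [Projectivization.mk_eq_mk_iff, Proportional, ← aeval_cons_one]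
  constructor
  · rintro ⟨-, c, hc⟩
    exact ⟨c, c.ne_zero, fun i => (congrFun hc i).symm⟩
  · rintro ⟨c, hc, h⟩
    have h' : (fun i => MvPolynomial.aeval ![x, 1] (a i)) =
        c • (fun i => MvPolynomial.aeval ![y, 1] (a i)) := funext h
    refine ⟨?_, Units.mk0 c hc, h'.symm⟩
    rw [h']
    exact smul_ne_zero hc hy0

theorem exists_mapsTo_affinePoint {a : Fin (d + 1) → MvPolynomial (Fin 2) K}
    (ha : ∀ i, (a i).IsHomogeneous n) {y : Kbar} {i : Fin (d + 1)}
    (hy : aeval y (dehom (a i)) ≠ 0) : ∃ Q, MapsTo a (affinePoint K y) Q := by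
  have h : (fun i => MvPolynomial.aeval ![y, 1] (a i)) ≠ 0 := fun h0 =>
    hy (by rw [← aeval_cons_one]; exact congrFun h0 i)
  exact ⟨_, (mapsTo_mk ha _ _).mpr ⟨h, rfl⟩⟩

/-- Sharing the image of infinity makes `y` a root of `α j * a i - α i * a j`, which is a nonzero
polynomial by linear independence when `α j ≠ 0`. -/
theorem finite_mapsTo_infinityPoint (hd : 1 ≤ d) {a : Fin (d + 1) → MvPolynomial (Fin 2) K}
    (ha : a ∈ param K n d) :
    {y : Kbar | ∃ Q, MapsTo a (affinePoint K y) Q ∧ MapsTo a (infinityPoint K) Q}.Finite := by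
  let α : Fin (d + 1) → K := fun i => MvPolynomial.aeval ![1, 0] (a i)
  have hα : ∀ i, MvPolynomial.aeval (![1, 0] : Fin 2 → Kbar) (a i) = algebraMap K Kbar (α i) := by
    intro i
    have := MvPolynomial.aeval_algebraMap_apply Kbar (![1, 0] : Fin 2 → K) (a i)
    rw [← this]
    congr 2
    funext j
    fin_cases j <;> simp
  have key : ∀ y Q, MapsTo a (affinePoint K y) Q → MapsTo a (infinityPoint K) Q →
      (∃ j, α j ≠ 0) ∧ ∀ i j, algebraMap K Kbar (α j) * aeval y (dehom (a i)) =
        algebraMap K Kbar (α i) * aeval y (dehom (a j)) := by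
    intro y Q hy hi
    obtain ⟨h1, rfl⟩ := (mapsTo_mk ha.1 _ Q).mp hy
    obtain ⟨h2, h3⟩ := (mapsTo_mk ha.1 _ _).mp hi
    obtain ⟨c, hc⟩ := (Projectivization.mk_eq_mk_iff' _ _ _ _ _).mp h3
    constructor
    · by_contra! h
      apply h2
      funext i
      rw [hα, h i, map_zero]
      rfl
    · intro i j
      have hi := congrFun hc i
      have hj := congrFun hc j
      simp only [Pi.smul_apply, smul_eq_mul, hα, aeval_cons_one] at hi hj
      rw [← hi, ← hj]
      ring
  by_cases h : ∃ j, α j ≠ 0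
  · obtain ⟨j, hj⟩ := h
    have : Nontrivial (Fin (d + 1)) := Fin.nontrivial_iff_two_le.mpr (by omega)
    obtain ⟨i, hij⟩ := exists_ne j
    have hne : C (α j) * dehom (a i) - C (α i) * dehom (a j) ≠ 0 := by
      intro h0
      refine hj (eq_zero_of_smul_eq_smul ha.2.1 hij (c' := α i) ?_)
      rw [MvPolynomial.smul_eq_C_mul, MvPolynomial.smul_eq_C_mul]
      refine aeval_inj ((ha.1 i).C_mul _) ((ha.1 j).C_mul _) ?_
      rw [map_mul, map_mul]
      simpa [dehom] using sub_eq_zero.mp h0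
    refine (finite_zeros hne).subset ?_
    rintro y ⟨Q, h1, h2⟩
    simp [(key y Q h1 h2).2 i j]
  · refine Set.finite_empty.subset ?_
    rintro y ⟨Q, h1, h2⟩
    exact (h (key y Q h1 h2).1).elim

theorem exists_encard_fiber (hd : 1 ≤ d) {a : Fin (d + 1) → MvPolynomial (Fin 2) K}
    (ha : a ∈ param K n d) {h : RatFunc K} (hh : ¬ ∃ c, h = RatFunc.C c)
    (hE : imageField a = IntermediateField.adjoin K {h}) :
    ∃ (s : ℕ) (B : Set Kbar), B.Finite ∧ s ∣ max h.num.natDegree h.denom.natDegree ∧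
      ((derivative h.num ≠ 0 ∨ derivative h.denom ≠ 0) →
        s = max h.num.natDegree h.denom.natDegree) ∧
      ∀ y ∉ B, (∃ Q, MapsTo a (affinePoint K y) Q) ∧
        ∀ Q, MapsTo a (affinePoint K y) Q → {P | MapsTo a P Q}.encard = s := by
  obtain ⟨s, B, hB, hs, hs', hcard⟩ := exists_encard_cross (L := Kbar) h.isCoprime_num_denom
    (max_natDegree_pos hh)
  obtain ⟨B', hB', hiff⟩ := exists_finite_proportional_iff_cross (L := Kbar) ha hh hE
  refine ⟨s, B ∪ B' ∪ {y | aeval y (dehom (a 0)) = 0} ∪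
    {y : Kbar | ∃ Q, MapsTo a (affinePoint K y) Q ∧ MapsTo a (infinityPoint K) Q},
    ((hB.union hB').union (finite_zeros (dehom_param_ne_zero ha 0))).union
      (finite_mapsTo_infinityPoint hd ha), hs, hs', fun y hy => ?_⟩
  simp only [Set.mem_union, not_or] at hy
  obtain ⟨⟨⟨hy1, hy2⟩, hy3⟩, hy4⟩ := hy
  refine ⟨exists_mapsTo_affinePoint ha.1 hy3, fun Q hQ => ?_⟩
  rw [← hcard y hy1, ← affinePoint_injective.encard_image]
  congr 1
  ext P
  simp only [Set.mem_ofPred_eq, Set.mem_image]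
  constructor
  · intro hP
    rcases eq_infinityPoint_or_affinePoint P with rfl | ⟨x, rfl⟩
    · exact (hy4 ⟨Q, hQ, hP⟩).elim
    · exact ⟨x, (hiff y hy2 x).mp ((mapsTo_affinePoint_iff ha.1 hQ x).mp hP), rfl⟩
  · rintro ⟨x, hx, rfl⟩
    exact (mapsTo_affinePoint_iff ha.1 hQ x).mpr ((hiff y hy2 x).mpr hx)

theorem exists_hasGenericDegree (hd : 1 ≤ d) {a : Fin (d + 1) → MvPolynomial (Fin 2) K}
    (ha : a ∈ param K n d) {h : RatFunc K} (hh : ¬ ∃ c, h = RatFunc.C c)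
    (hE : imageField a = IntermediateField.adjoin K {h}) :
    ∃ s : ℕ, s ∣ max h.num.natDegree h.denom.natDegree ∧
      ((derivative h.num ≠ 0 ∨ derivative h.denom ≠ 0) →
        s = max h.num.natDegree h.denom.natDegree) ∧
      ∀ k, HasGenericDegree a k ↔ k = s := by
  obtain ⟨s, B, hB, hs, hs', hfib⟩ := exists_encard_fiber hd ha hh hE
  refine ⟨s, hs, hs', fun k => ⟨fun hk => ?_, ?_⟩⟩
  · have hG : ∀ y : Kbar, ∃ Q, y ∉ B → MapsTo a (affinePoint K y) Q := by
      intro y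
      by_cases hy : y ∈ B
      · exact ⟨Projectivization.mk Kbar (fun _ => 1) fun h => one_ne_zero (congrFun h 0),
          fun h => (h hy).elim⟩
      · obtain ⟨Q, hQ⟩ := (hfib y hy).1
        exact ⟨Q, fun _ => hQ⟩
    choose G hG using hG
    -- Finitely many exceptional images, each with a finite fibre outside `B`, exclude only finitely
    -- many `y`; the field `Kbar` is infinite, so some `y` is good for both `k` and `s`.
    have hfin : (B ∪ ⋃ Q ∈ {Q | (∃ P, MapsTo a P Q) ∧ {P | MapsTo a P Q}.encard ≠ k},
        {y | y ∉ B ∧ G y = Q}).Finite := by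
      refine hB.union (Set.Finite.biUnion hk fun Q _ => ?_)
      by_cases hQ : ∃ y, y ∉ B ∧ G y = Q
      · obtain ⟨y, hy, rfl⟩ := hQ
        have : {P | MapsTo a P (G y)}.Finite :=
          Set.finite_of_encard_eq_coe ((hfib y hy).2 _ (hG y hy))
        refine (this.preimage affinePoint_injective.injOn).subset ?_
        rintro z ⟨hz, hzy⟩
        change MapsTo a (affinePoint K z) (G y)
        rw [← hzy]
        exact hG z hz
      · refine Set.finite_empty.subset ?_
        rintro z hz
        exact (hQ ⟨z, hz⟩).elim
    obtain ⟨y, hy⟩ := hfin.exists_notMem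
    simp only [Set.mem_union, Set.mem_iUnion, Set.mem_ofPred_eq, not_or, not_exists, not_and] at hy
    have h1 := hG y hy.1
    by_contra hks
    refine hy.2 (G y) ⟨⟨_, h1⟩, ?_⟩ hy.1 rfl
    rw [(hfib y hy.1).2 _ h1]
    exact fun h => hks (by exact_mod_cast h.symm)
  · rintro rfl
    refine ((Set.Finite.biUnion hB fun y _ => (Set.Subsingleton.finite (s :=
      {Q | MapsTo a (affinePoint K y) Q}) fun Q hQ Q' hQ' => mapsTo_unique hQ hQ')).union
      (Set.Subsingleton.finite (s := {Q | MapsTo a (infinityPoint K) Q})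
        fun Q hQ Q' hQ' => mapsTo_unique hQ hQ')).subset ?_
    rintro Q ⟨⟨P, hP⟩, hQ⟩
    rcases eq_infinityPoint_or_affinePoint P with rfl | ⟨y, rfl⟩
    · exact Or.inr hP
    · left
      by_cases hy : y ∈ B
      · exact Set.mem_biUnion hy hP
      · exact (hQ ((hfib y hy).2 Q hP)).elim

theorem dvd_of_mapDegree (hd : 1 ≤ d) {μ : Fin d → ℕ} {a : Fin (d + 1) → MvPolynomial (Fin 2) K}
    (ha : a ∈ stratum K n d μ) (j : Fin d) : mapDegree a ∣ μ j := by
  have hE := RatFunc.Luroth.eq_adjoin_generator (E := imageField a)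
  have h := dvd_muType_of_imageField_eq ha
    (RatFunc.Luroth.generator_ne_C (imageField_ne_bot hd ha.1)) hE j
  rw [← RatFunc.finrank_eq_max_natDegree, ← hE] at h
  exact h

theorem dvd_of_hasGenericDegree (hd : 1 ≤ d) {μ : Fin d → ℕ}
    {a : Fin (d + 1) → MvPolynomial (Fin 2) K} (ha : a ∈ stratum K n d μ) {k : ℕ}
    (hk : HasGenericDegree a k) (j : Fin d) : k ∣ μ j := by
  have hE := RatFunc.Luroth.eq_adjoin_generator (E := imageField a)
  have hh := RatFunc.Luroth.generator_ne_C (imageField_ne_bot hd ha.1)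
  obtain ⟨s, hs, -, hs'⟩ := exists_hasGenericDegree hd ha.1 hh hE
  rw [(hs' k).mp hk]
  exact hs.trans (dvd_muType_of_imageField_eq ha hh hE j)

end Projective

/-! ### A Hilbert–Burch resolution for bidiagonal matrices. -/

section Bidiagonal

variable {R : Type*} [CommRing R]

/-- The product `F_0 ⋯ F_{i-1} T_i ⋯ T_{d-1}`; up to signs these are the maximal minors of the
bidiagonal matrix with entries `F_j` and `-T_j` in column `j`. -/
def minor (F T : ℕ → R) (d i : ℕ) : R := (∏ j ∈ Finset.range i, F j) * ∏ j ∈ Finset.Ico i d, T j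

theorem minor_self (F T : ℕ → R) (d : ℕ) : minor F T d d = ∏ j ∈ Finset.range d, F j := by
  simp [minor]

theorem minor_succ (F T : ℕ → R) {d i : ℕ} (h : i ≤ d) :
    minor F T (d + 1) i = minor F T d i * T d := by
  rw [minor, minor, Finset.prod_Ico_succ_top h, mul_assoc]

theorem mul_minor_eq (F T : ℕ → R) {d i : ℕ} (h : i < d) :
    F i * minor F T d i = T i * minor F T d (i + 1) := by
  rw [minor, minor, Finset.prod_range_succ, Finset.prod_eq_prod_Ico_succ_bot h]
  ring

theorem dvd_of_dvd_prod_mul {F T : ℕ → R} (hFT : ∀ i j r, T j ∣ F i * r → T j ∣ r) (j m : ℕ) (r : R)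
    (h : T j ∣ (∏ i ∈ Finset.range m, F i) * r) : T j ∣ r := by
  induction m with
  | zero => simpa using h
  | succ m ih =>
    rw [Finset.prod_range_succ, mul_comm _ (F m), mul_assoc] at h
    exact ih (hFT _ _ _ h)

/-- All minors but the last contain `T d`, and `T d` can be cancelled against the `F i`, so it
divides the last coefficient. Subtracting a multiple of the last column leaves a syzygy of the
shorter tuple. The convention `w d = 0` lets the last row follow the general formula. -/
theorem exists_of_sum_mul_minor_eq_zero [IsDomain R] {F T : ℕ → R} (hT : ∀ j, T j ≠ 0)
    (hFT : ∀ i j r, T j ∣ F i * r → T j ∣ r) (d : ℕ) (c : ℕ → R)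
    (h : ∑ i ∈ Finset.range (d + 1), c i * minor F T d i = 0) :
    ∃ w : ℕ → R, w d = 0 ∧ c 0 = F 0 * w 0 ∧
      ∀ i < d, c (i + 1) = F (i + 1) * w (i + 1) - T i * w i := by
  induction d generalizing c with
  | zero => exact ⟨0, rfl, by simpa [minor] using h, fun i hi => absurd hi (Nat.not_lt_zero i)⟩
  | succ d ih =>
    have hsum : ∑ i ∈ Finset.range (d + 1), c i * minor F T (d + 1) i =
        T d * ∑ i ∈ Finset.range (d + 1), c i * minor F T d i := by
      rw [Finset.mul_sum]
      refine Finset.sum_congr rfl fun i hi => ?_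
      rw [minor_succ F T (Nat.lt_succ_iff.mp (Finset.mem_range.mp hi))]
      ring
    rw [Finset.sum_range_succ, hsum, minor_self] at h
    obtain ⟨e, he⟩ : T d ∣ c (d + 1) := by
      refine dvd_of_dvd_prod_mul hFT d (d + 1) _
        ⟨-∑ i ∈ Finset.range (d + 1), c i * minor F T d i, ?_⟩
      linear_combination h
    rw [he] at h
    have h2 : ∑ i ∈ Finset.range (d + 1), c i * minor F T d i +
        e * ∏ j ∈ Finset.range (d + 1), F j = 0 := by
      apply mul_left_cancel₀ (hT d)
      linear_combination h
    -- Adding `e` times the last column clears entry `d + 1` and changes entry `d` by `e * F d`;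
    -- accordingly the new `w` takes the value `-e` at `d`.
    obtain ⟨w, hw, hw0, hw1⟩ := ih (fun i => if i = d then c d + e * F d else c i) (by
      rw [Finset.sum_range_succ, if_pos rfl, minor_self]
      rw [Finset.sum_range_succ, minor_self, Finset.prod_range_succ] at h2
      rw [← h2, Finset.sum_congr rfl fun i hi => by
        rw [if_neg (Finset.mem_range.mp hi).ne]]
      ring)
    refine ⟨fun i => if i < d then w i else if i = d then -e else 0, by simp, ?_, fun i hi => ?_⟩
    · rcases Nat.eq_zero_or_pos d with rfl | hd
      · simp only [if_true, hw, lt_irrefl, if_false] at hw0 ⊢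
        linear_combination hw0
      · simp only [hd, if_true, hd.ne] at hw0 ⊢
        simpa using hw0
    · rcases Nat.lt_succ_iff_lt_or_eq.mp hi with hid | rfl
      · have h3 := hw1 i hid
        rcases Nat.lt_or_eq_of_le (Nat.succ_le_of_lt hid) with h4 | h4
        · simp only [Nat.succ_eq_add_one] at h4
          simp only [h4, h4.ne, hid, if_true, if_false] at h3 ⊢
          exact h3
        · simp only [Nat.succ_eq_add_one] at h4
          simp only [h4, hid, if_true, lt_irrefl, if_false, hw] at h3 ⊢
          linear_combination h3
      · simp [he]

/-- The bidiagonal matrix with entries `F_j` and `-T_j` in rows `j` and `j + 1` of column `j`. -/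
def bidiagonal (F T : ℕ → R) (d : ℕ) : Matrix (Fin (d + 1)) (Fin d) R :=
  fun i j => if (i : ℕ) = j then F j else if (i : ℕ) = j + 1 then -T j else 0

/-- The extension of a vector by zero. -/
def extend {d : ℕ} (w : Fin d → R) (i : ℕ) : R := if h : i < d then w ⟨i, h⟩ else 0

theorem sum_ite_eq_extend {d : ℕ} (G : ℕ → R) (w : Fin d → R) (i : ℕ) :
    ∑ j : Fin d, (if i = (j : ℕ) then G j * w j else 0) = G i * extend w i := by
  unfold extend
  split_ifs with h
  · rw [Finset.sum_eq_single ⟨i, h⟩]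
    · simp
    · intro j _ hj
      rw [if_neg]
      rintro rfl
      exact hj rfl
    · simp
  · rw [mul_zero]
    refine Finset.sum_eq_zero fun j _ => ?_
    rw [if_neg]
    rintro rfl
    exact h j.2

theorem bidiagonal_mulVec_zero (F T : ℕ → R) {d : ℕ} (w : Fin d → R) :
    (bidiagonal F T d).mulVec w 0 = F 0 * extend w 0 := by
  rw [← sum_ite_eq_extend]
  simp only [Matrix.mulVec, dotProduct, bidiagonal]
  refine Finset.sum_congr rfl fun j _ => ?_
  simp only [Fin.val_zero]
  split_ifs with h1 h2
  · rfl
  · exact h2.elim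
  · rw [zero_mul]

theorem bidiagonal_mulVec_succ (F T : ℕ → R) {d : ℕ} (w : Fin d → R) (i : Fin d) :
    (bidiagonal F T d).mulVec w i.succ = F (i + 1) * extend w (i + 1) - T i * extend w i := by
  rw [← sum_ite_eq_extend, ← sum_ite_eq_extend, ← Finset.sum_sub_distrib]
  simp only [Matrix.mulVec, dotProduct, bidiagonal]
  refine Finset.sum_congr rfl fun j _ => ?_
  simp only [Fin.val_succ, Nat.add_right_cancel_iff]
  split_ifs with h1 h2
  · omega
  · ring
  · ring
  · ring

theorem bidiagonal_mulVecLin_injective [IsDomain R] {F T : ℕ → R} (hF : ∀ j, F j ≠ 0) (d : ℕ) :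
    Function.Injective (bidiagonal F T d).mulVecLin := by
  rw [← LinearMap.ker_eq_bot, LinearMap.ker_eq_bot']
  intro w hw
  have key : ∀ i, extend w i = 0 := by
    intro i
    induction i with
    | zero =>
      have := congrFun hw 0
      rw [Matrix.mulVecLin_apply, bidiagonal_mulVec_zero] at this
      exact (mul_eq_zero.mp this).resolve_left (hF 0)
    | succ i ih =>
      by_cases h : i < d
      · have := congrFun hw (Fin.succ ⟨i, h⟩)
        rw [Matrix.mulVecLin_apply, bidiagonal_mulVec_succ, ih, mul_zero, sub_zero] at this
        exact (mul_eq_zero.mp this).resolve_left (hF _)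
      · exact dif_neg (by omega)
  funext i
  have := key i
  rwa [extend, dif_pos i.2] at this

theorem bidiagonal_exact [IsDomain R] {F T : ℕ → R} (hT : ∀ j, T j ≠ 0)
    (hFT : ∀ i j r, T j ∣ F i * r → T j ∣ r) (d : ℕ) :
    Function.Exact (bidiagonal F T d).mulVecLin
      (Fintype.linearCombination R fun i : Fin (d + 1) => minor F T d i) := by
  intro c
  simp only [Fintype.linearCombination_apply, smul_eq_mul]
  constructor
  · intro h
    obtain ⟨w, hw, hw0, hw1⟩ := exists_of_sum_mul_minor_eq_zero hT hFT d (extend c) (by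
      rw [← h, Finset.sum_range]
      exact Finset.sum_congr rfl fun i _ => by rw [extend, dif_pos i.2])
    have hext : ∀ i ≤ d, extend (fun i : Fin d => w i) i = w i := by
      intro i hi
      rcases Nat.lt_or_eq_of_le hi with h | rfl
      · rw [extend, dif_pos h]
      · rw [extend, dif_neg (lt_irrefl _), hw]
    refine ⟨fun i => w i, ?_⟩
    funext i
    rw [Matrix.mulVecLin_apply]
    have hci : c i = extend c i := by rw [extend, dif_pos i.2]
    rw [hci]
    induction i using Fin.cases with
    | zero => rw [bidiagonal_mulVec_zero, hext 0 (Nat.zero_le d), Fin.val_zero, hw0]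
    | succ i =>
      rw [bidiagonal_mulVec_succ, hext _ i.2, hext _ i.2.le, Fin.val_succ, hw1 i i.2]
  · rintro ⟨w, rfl⟩
    rw [Fin.sum_univ_succ, Matrix.mulVecLin_apply, bidiagonal_mulVec_zero]
    simp only [bidiagonal_mulVec_succ, Fin.val_zero, Fin.val_succ, sub_mul]
    rw [Finset.sum_sub_distrib,
      Fin.sum_univ_eq_sum_range (fun i => F (i + 1) * extend w (i + 1) * minor F T d (i + 1)),
      Fin.sum_univ_eq_sum_range (fun i => T i * extend w i * minor F T d (i + 1)), ← add_sub_assoc,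
      add_comm, ← Finset.sum_range_succ' (fun i => F i * extend w i * minor F T d i),
      Finset.sum_range_succ, show extend w d = 0 from dif_neg (lt_irrefl _), mul_zero, zero_mul,
      add_zero, sub_eq_zero]
    refine Finset.sum_congr rfl fun i hi => ?_
    linear_combination extend w i * mul_minor_eq F T (Finset.mem_range.mp hi)

end Bidiagonal

/-! ### Generating `K(y)` by two polynomials in `y`. -/

section Generation

/-- The ratio `ζ = z / Y` is a root of unity, hence algebraic. The second equation is then linear in
the transcendental `Y`, which forces `ζ ^ (e + 1) = ζ ^ e = 1`. -/
theorem eq_of_pow_eq_of_transcendental {K Ω : Type*} [Field K] [Field Ω] [Algebra K Ω] {Y z : Ω}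
    (hY : Transcendental K Y) {m e : ℕ} (hm : m ≠ 0) (h1 : z ^ m = Y ^ m)
    (h2 : z ^ (e + 1) + z ^ e = Y ^ (e + 1) + Y ^ e) : z = Y := by
  have hY0 : Y ≠ 0 := fun h => hY (h ▸ isAlgebraic_zero)
  obtain ⟨ζ, rfl⟩ : ∃ ζ, z = ζ * Y := ⟨z / Y, by field_simp⟩
  have hζ1 : ζ ^ m = 1 := by
    rw [mul_pow] at h1
    exact mul_right_cancel₀ (pow_ne_zero m hY0) (h1.trans (one_mul _).symm)
  have hζ : ζ ∈ algebraicClosure K Ω := by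
    rw [mem_algebraicClosure_iff]
    exact IsAlgebraic.of_pow (Nat.pos_of_ne_zero hm) (hζ1 ▸ isAlgebraic_one)
  have h3 : (ζ ^ (e + 1) - 1) * Y = 1 - ζ ^ e := by
    apply mul_left_cancel₀ (pow_ne_zero e hY0)
    simp only [mul_pow] at h2
    linear_combination h2
  by_cases h4 : ζ ^ (e + 1) - 1 = 0
  · rw [h4, zero_mul] at h3
    have h5 : ζ ^ e = 1 := (sub_eq_zero.mp h3.symm).symm
    rw [pow_succ, h5, one_mul, sub_eq_zero] at h4
    rw [h4, one_mul]
  · refine (hY ((mem_algebraicClosure_iff).mp ?_)).elim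
    have : Y = (1 - ζ ^ e) / (ζ ^ (e + 1) - 1) := by
      rw [eq_div_iff h4, mul_comm, h3]
    rw [this]
    exact div_mem (sub_mem (one_mem _) (pow_mem hζ _)) (sub_mem (pow_mem hζ _) (one_mem _))

theorem derivative_X_pow_add_X_pow_ne_zero {K : Type*} [Field K] (e : ℕ) :
    derivative (X ^ (e + 1) + X ^ e : K[X]) ≠ 0 := by
  rw [derivative_add, derivative_X_pow, derivative_X_pow, Nat.add_sub_cancel]
  rcases e with _ | e
  · simp
  · intro h
    -- The two coefficients are consecutive integers, so they cannot both vanish in `K`.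
    have h1 := congrArg (coeff · (e + 1)) h
    have h2 := congrArg (coeff · e) h
    simp only [coeff_add, coeff_C_mul, coeff_X_pow, coeff_zero, Nat.add_sub_cancel] at h1 h2
    simp at h1 h2
    rw [h2, zero_add] at h1
    exact one_ne_zero h1

/-- The minimal polynomial of `y` over `E` divides `f₁` and `f₂`. It is separable, since otherwise
`f₂'` would vanish at the transcendental `y`, and `y` is the only common root of `f₁` and `f₂`. So
it is linear. -/
theorem mem_of_pow_mem_of_transcendental {K M : Type*} [Field K] [Field M] [Algebra K M]
    (E : IntermediateField K M) {y : M} (hy : Transcendental K y) {m e : ℕ} (hm : m ≠ 0)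
    (h1 : y ^ m ∈ E) (h2 : y ^ (e + 1) + y ^ e ∈ E) : y ∈ E := by
  let Ω := AlgebraicClosure M
  let f₁ : E[X] := X ^ m - C ⟨_, h1⟩
  let f₂ : E[X] := X ^ (e + 1) + X ^ e - C ⟨_, h2⟩
  have hf₁ : aeval y f₁ = 0 := by
    simp only [f₁, map_sub, map_pow, aeval_X, aeval_C]
    exact sub_self _
  have hf₂ : aeval y f₂ = 0 := by
    simp only [f₂, map_sub, map_add, map_pow, aeval_X, aeval_C]
    exact sub_self _
  have hint : IsIntegral E y := ⟨f₁, monic_X_pow_sub_C _ hm, hf₁⟩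
  have hYtr : Transcendental K (algebraMap M Ω y) := fun h =>
    hy ((isAlgebraic_algebraMap_iff (algebraMap M Ω).injective).mp h)
  have hsep : (minpoly E y).Separable := by
    rw [separable_iff_derivative_ne_zero (minpoly.irreducible hint)]
    intro h0
    obtain ⟨r, hr⟩ := minpoly.dvd E y hf₂
    have h3 := congrArg (fun f => aeval y (derivative f)) hr
    simp only [derivative_mul, h0, zero_mul, zero_add, map_mul, minpoly.aeval] at h3
    refine derivative_X_pow_add_X_pow_ne_zero (K := K) e ?_
    by_contra h4
    apply hy
    refine ⟨_, h4, ?_⟩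
    simpa [f₂, derivative_X_pow] using h3
  have hroot : ∀ z : Ω, z ∈ (minpoly E y).rootSet Ω → z = algebraMap M Ω y := by
    intro z hz
    have hz0 : aeval z (minpoly E y) = 0 := (mem_rootSet.mp hz).2
    refine eq_of_pow_eq_of_transcendental (m := m) (e := e) hYtr hm ?_ ?_
    · obtain ⟨r, hr⟩ := minpoly.dvd E y hf₁
      have h3 := congrArg (aeval z) hr
      rw [map_mul, hz0, zero_mul] at h3
      simp only [f₁, map_sub, map_pow, aeval_X, aeval_C] at h3
      rw [← map_pow]
      exact sub_eq_zero.mp h3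
    · obtain ⟨r, hr⟩ := minpoly.dvd E y hf₂
      have h3 := congrArg (aeval z) hr
      rw [map_mul, hz0, zero_mul] at h3
      simp only [f₂, map_sub, map_add, map_pow, aeval_X, aeval_C] at h3
      rw [← map_pow, ← map_pow, ← map_add]
      exact sub_eq_zero.mp h3
  have hdeg : (minpoly E y).natDegree = 1 := by
    refine le_antisymm ?_ (minpoly.natDegree_pos hint)
    rw [← card_rootSet_eq_natDegree (K := Ω) hsep (IsAlgClosed.splits _)]
    exact Fintype.card_le_one_iff.mpr fun u v =>
      Subtype.ext ((hroot u u.2).trans (hroot v v.2).symm)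
  obtain ⟨x, rfl⟩ := minpoly.mem_range_of_degree_eq_one E y
    (by rw [degree_eq_natDegree (minpoly.ne_zero hint), hdeg]; rfl)
  exact x.2

end Generation

/-! ### The explicit parametrization of degree `k`. -/

section Tuple

variable {K : Type*} [Field K]

theorem not_X_one_dvd_homogenize {f : K[X]} (hf : f.Monic) :
    ¬ (MvPolynomial.X 1 : MvPolynomial (Fin 2) K) ∣ f.homogenize f.natDegree := by
  classical
  rintro ⟨w, hw⟩
  have := congrArg (MvPolynomial.coeff (Finsupp.single 0 f.natDegree)) hw
  rw [coeff_homogenize, MvPolynomial.coeff_X_mul'] at this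
  simp [hf.coeff_natDegree] at this

/-- The tuple of products `∏_{j < i} f_j`, homogenized to degree `∑ j, deg f_j`. -/
noncomputable def tuple (f : ℕ → K[X]) (d : ℕ) : Fin (d + 1) → MvPolynomial (Fin 2) K :=
  fun i => minor (fun j => (f j).homogenize (f j).natDegree)
    (fun j => MvPolynomial.X 1 ^ (f j).natDegree) d i

variable {f : ℕ → K[X]}

theorem dehom_tuple (f : ℕ → K[X]) {d : ℕ} (i : Fin (d + 1)) :
    dehom (tuple f d i) = ∏ j ∈ Finset.range i, f j := by
  rw [dehom, tuple, minor, map_mul, map_prod, map_prod]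
  simp

theorem isHomogeneous_tuple (f : ℕ → K[X]) {d : ℕ} (i : Fin (d + 1)) :
    (tuple f d i).IsHomogeneous (∑ j ∈ Finset.range d, (f j).natDegree) := by
  rw [← Finset.sum_range_add_sum_Ico _ (Nat.lt_succ_iff.mp i.2)]
  refine MvPolynomial.IsHomogeneous.mul ?_ ?_
  · exact MvPolynomial.IsHomogeneous.prod _ _ _ fun j _ => isHomogeneous_homogenize _
  · exact MvPolynomial.IsHomogeneous.prod _ _ _ fun j _ => MvPolynomial.isHomogeneous_X_pow _ _

/-- After dehomogenizing, the entries are monic of strictly increasing degrees. -/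
theorem linearIndependent_tuple (hf : ∀ j, (f j).Monic) {d : ℕ}
    (hdeg : ∀ j < d, 0 < (f j).natDegree) : LinearIndependent K (tuple f d) := by
  let D : ℕ → ℕ := fun i => ∑ j ∈ Finset.range i, (f j).natDegree
  have hmono : ∀ i : Fin (d + 1), (dehom (tuple f d i)).Monic := fun i => by
    rw [dehom_tuple]
    exact monic_prod_of_monic _ _ fun j _ => hf j
  have hD : ∀ i : Fin (d + 1), (dehom (tuple f d i)).natDegree = D i := fun i => by
    rw [dehom_tuple, natDegree_prod_of_monic _ _ fun j _ => hf j]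
  have hDlt : ∀ i j : Fin (d + 1), i < j → D i < D j := by
    intro i j hij
    refine Finset.sum_lt_sum_of_subset (i := (i : ℕ))
      (Finset.range_subset_range.mpr (Fin.le_def.mp hij.le)) (Finset.mem_range.mpr hij)
      (by simp) (hdeg i (by omega)) (fun _ _ _ => Nat.zero_le _)
  have hinj : ∀ i j : Fin (d + 1), D i = D j → i = j := by
    intro i j hij
    rcases lt_trichotomy i j with h | h | h
    · exact absurd hij (hDlt i j h).ne
    · exact h
    · exact absurd hij (hDlt j i h).ne'
  rw [Fintype.linearIndependent_iff]
  intro c hc i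
  have hc' : ∑ i, C (c i) * dehom (tuple f d i) = 0 := by
    have := congrArg (MvPolynomial.aeval (R := K) ![(X : K[X]), 1]) hc
    rw [map_sum, map_zero] at this
    rw [← this]
    exact Finset.sum_congr rfl fun i _ => by rw [map_smul, smul_eq_C_mul, dehom]
  have hsum := degree_sum_eq_of_disjoint (fun i => C (c i) * dehom (tuple f d i)) Finset.univ (by
    rintro i ⟨-, hi⟩ j ⟨-, hj⟩ hij
    have hci : c i ≠ 0 := fun h => hi (by simp [h])
    have hcj : c j ≠ 0 := fun h => hj (by simp [h])
    simp only [Function.onFun, Function.comp]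
    rw [degree_C_mul hci, degree_C_mul hcj, degree_eq_natDegree (hmono i).ne_zero,
      degree_eq_natDegree (hmono j).ne_zero, hD, hD]
    exact fun h => hij (hinj i j (by exact_mod_cast h)))
  rw [hc', degree_zero] at hsum
  have := (Finset.sup_eq_bot_iff _ _).mp hsum.symm i (Finset.mem_univ i)
  rw [degree_eq_bot] at this
  exact C_eq_zero.mp ((mul_eq_zero.mp this).resolve_right (hmono i).ne_zero)

/-- The first entry is a power of the prime `t`, and the last is not divisible by `t` because the `f
j` are monic. -/
theorem isUnit_of_dvd_tuple (hf : ∀ j, (f j).Monic) {d : ℕ} {g : MvPolynomial (Fin 2) K}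
    (hg : ∀ i, g ∣ tuple f d i) : IsUnit g := by
  have hp : Prime (MvPolynomial.X 1 : MvPolynomial (Fin 2) K) := MvPolynomial.X_prime
  have h0 : g ∣ MvPolynomial.X 1 ^ (∑ j ∈ Finset.range d, (f j).natDegree) := by
    have := hg 0
    rwa [tuple, minor, Fin.val_zero, Finset.range_zero, Finset.prod_empty, one_mul,
      Finset.prod_pow_eq_pow_sum, ← Finset.range_eq_Ico] at this
  obtain ⟨i, -, hi⟩ := (dvd_prime_pow hp _).mp h0
  rcases Nat.eq_zero_or_pos i with rfl | hpos
  · rw [pow_zero] at hi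
    exact hi.isUnit_iff.mpr isUnit_one
  · have h1 : MvPolynomial.X 1 ∣ tuple f d (Fin.last d) :=
      ((dvd_pow_self _ hpos.ne').trans hi.symm.dvd).trans (hg _)
    rw [tuple, Fin.val_last, minor_self] at h1
    obtain ⟨j, -, hj⟩ := hp.exists_mem_finset_dvd h1
    exact (not_X_one_dvd_homogenize (hf j) hj).elim

theorem tuple_mem_param (hf : ∀ j, (f j).Monic) {d : ℕ} (hdeg : ∀ j < d, 0 < (f j).natDegree) :
    tuple f d ∈ param K (∑ j ∈ Finset.range d, (f j).natDegree) d :=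
  ⟨isHomogeneous_tuple f, linearIndependent_tuple hf hdeg, fun _ hg => isUnit_of_dvd_tuple hf hg⟩

theorem hasMuType_tuple (hf : ∀ j, (f j).Monic) {d : ℕ} {μ : Fin d → ℕ} (hμ : Monotone μ)
    (hμ1 : ∀ i, 1 ≤ μ i) (hdeg : ∀ j : Fin d, (f j).natDegree = μ j) :
    HasMuType (tuple f d) μ := by
  have hp : Prime (MvPolynomial.X 1 : MvPolynomial (Fin 2) K) := MvPolynomial.X_prime
  refine ⟨hμ, hμ1, bidiagonal (fun j => (f j).homogenize (f j).natDegree)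
    (fun j => MvPolynomial.X 1 ^ (f j).natDegree) d, fun i j => ?_,
    bidiagonal_mulVecLin_injective (fun j => homogenize_ne_zero (hf j).ne_zero le_rfl) d,
    bidiagonal_exact (fun j => pow_ne_zero _ hp.ne_zero) (fun i j r h =>
      hp.pow_dvd_of_dvd_mul_left _ (not_X_one_dvd_homogenize (hf i)) h) d⟩
  rw [← hdeg j, bidiagonal]
  split_ifs
  · exact isHomogeneous_homogenize _
  · exact (MvPolynomial.isHomogeneous_X_pow _ _).neg
  · exact MvPolynomial.isHomogeneous_zero _ _ _

/-- Consecutive ratios recover `g 0 (h)` and `g 1 (h)`, both available because `d ≥ 2`; these two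
already generate `K(h)`. -/
theorem imageField_tuple {d : ℕ} (hd : 2 ≤ d) {h : K[X]} {g : ℕ → K[X]} (hg : ∀ j, (g j).Monic)
    (hh : Transcendental K (algebraMap K[X] (RatFunc K) h)) {m e : ℕ} (hm : m ≠ 0)
    (hg0 : g 0 = X ^ m) (hg1 : g 1 = X ^ (e + 1) + X ^ e) :
    imageField (tuple (fun j => (g j).comp h) d) =
      IntermediateField.adjoin K {algebraMap K[X] (RatFunc K) h} := by
  set y := algebraMap K[X] (RatFunc K) h
  have hval : ∀ j, algebraMap K[X] (RatFunc K) ((g j).comp h) = aeval y (g j) := by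
    intro j
    rw [comp_eq_aeval, ← aeval_algebraMap_apply]
  have hne : ∀ j, aeval y (g j) ≠ 0 := fun j h0 => hh ⟨g j, (hg j).ne_zero, h0⟩
  have htuple : ∀ i : Fin (d + 1), algebraMap K[X] (RatFunc K)
      (dehom (tuple (fun j => (g j).comp h) d i)) = ∏ j ∈ Finset.range i, aeval y (g j) := by
    intro i
    rw [dehom_tuple, map_prod]
    exact Finset.prod_congr rfl fun j _ => hval j
  apply le_antisymm
  · refine IntermediateField.adjoin_le_iff.mpr ?_
    rintro _ ⟨i, j, rfl⟩
    rw [aeval_ratFunc_X, aeval_ratFunc_X, htuple, htuple]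
    have : ∀ u : K[X], aeval y u ∈ IntermediateField.adjoin K {y} := fun u =>
      aeval_mem_adjoin_singleton K y |> IntermediateField.algebra_adjoin_le_adjoin K _
    exact div_mem (prod_mem fun j _ => this _) (prod_mem fun j _ => this _)
  · rw [IntermediateField.adjoin_simple_le_iff]
    refine mem_of_pow_mem_of_transcendental _ hh (m := m) (e := e) hm ?_ ?_
    · have := div_mem_imageField (tuple (fun j => (g j).comp h) d) ⟨1, by omega⟩ ⟨0, by omega⟩
      rw [htuple, htuple] at this
      simpa [hg0] using this
    · have := div_mem_imageField (tuple (fun j => (g j).comp h) d) ⟨2, by omega⟩ ⟨1, by omega⟩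
      rw [htuple, htuple] at this
      simp only [Finset.prod_range_succ, Finset.prod_range_zero, one_mul] at this
      rw [mul_div_cancel_left₀ _ (hne 0), hg1] at this
      simpa using this

theorem exists_stratum_of_dvd {n d : ℕ} (hd : 2 ≤ d) {μ : Fin d → ℕ} (hμ : Monotone μ)
    (hμ1 : ∀ i, 1 ≤ μ i) (hμn : ∑ i, μ i = n) {k : ℕ} (hk : 1 < k) (hdvd : ∀ i, k ∣ μ i) :
    ∃ a ∈ stratum K n d μ, HasGenericDegree a k ∧ mapDegree a = k := by
  -- The default `1` keeps `ν j` nonzero for all `j`, so that every `g j` is monic of degree `ν j`.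
  let ν : ℕ → ℕ := fun j => if h : j < d then μ ⟨j, h⟩ / k else 1
  have hν : ∀ j : Fin d, ν j * k = μ j := fun j => by
    simp only [ν, dif_pos j.2]
    exact Nat.div_mul_cancel (hdvd j)
  have hν1 : ∀ j, ν j ≠ 0 := by
    intro j hj
    by_cases h : j < d
    · have := hν ⟨j, h⟩
      rw [hj, zero_mul] at this
      have := hμ1 ⟨j, h⟩
      omega
    · simp [ν, h] at hj
  -- The summand `X` gives the derivative constant term `1`, so `h` stays separable even when the
  -- characteristic divides `k`.
  let h : K[X] := X ^ k + X
  have hhm : h.Monic := monic_X_pow_add (by rw [degree_X]; exact_mod_cast hk)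
  have hhk : h.natDegree = k := by
    simp only [h]
    compute_degree!
    · simp [hk.ne]
    · omega
  have hh' : derivative h ≠ 0 := by
    intro h0
    have := congrArg (coeff · 0) h0
    simp [h, coeff_derivative, coeff_X_pow, hk.ne] at this
  let g : ℕ → K[X] := fun j => if j = 0 then X ^ ν 0 else X ^ ν j + X ^ (ν j - 1)
  have hdeglt : ∀ j, (X ^ (ν j - 1) : K[X]).degree < ν j := fun j => by
    rw [degree_X_pow]
    have := hν1 j
    exact_mod_cast (show ν j - 1 < ν j by omega)
  have hg : ∀ j, (g j).Monic := by
    intro j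
    simp only [g]
    split_ifs
    · exact monic_X_pow _
    · exact monic_X_pow_add (hdeglt j)
  have hgdeg : ∀ j, (g j).natDegree = ν j := by
    intro j
    simp only [g]
    split_ifs with h0
    · rw [natDegree_X_pow, h0]
    · rw [natDegree_add_eq_left_of_degree_lt (by rw [degree_X_pow (ν j)]; exact hdeglt j),
        natDegree_X_pow]
  have hf : ∀ j, ((g j).comp h).Monic := fun j => (hg j).comp hhm (by omega)
  have hfdeg : ∀ j : Fin d, ((g j).comp h).natDegree = μ j := fun j => by
    rw [natDegree_comp, hgdeg, hhk, hν]
  have hsum : ∑ j ∈ Finset.range d, ((g j).comp h).natDegree = n := by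
    rw [Finset.sum_range, ← hμn]
    exact Finset.sum_congr rfl fun j _ => hfdeg j
  have hnum : (algebraMap K[X] (RatFunc K) h).num = h := RatFunc.num_algebraMap h
  have hden : (algebraMap K[X] (RatFunc K) h).denom = 1 := RatFunc.denom_algebraMap h
  have hmax : max (algebraMap K[X] (RatFunc K) h).num.natDegree
      (algebraMap K[X] (RatFunc K) h).denom.natDegree = k := by
    rw [hnum, hden, hhk, natDegree_one, Nat.max_zero]
  have hC : ¬ ∃ c, algebraMap K[X] (RatFunc K) h = RatFunc.C c := by
    rw [RatFunc.eq_C_iff, hnum, hhk]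
    omega
  have hE := imageField_tuple hd hg (RatFunc.transcendental_of_ne_C _ hC) (m := ν 0)
    (e := ν 1 - 1) (hν1 0) (by simp [g]) (by
      have := hν1 1
      simp only [g, one_ne_zero, if_false]
      rw [Nat.sub_add_cancel (by omega)])
  have hparam := tuple_mem_param hf (d := d) (fun j hj => by
    rw [hfdeg ⟨j, hj⟩]
    exact hμ1 _)
  rw [hsum] at hparam
  refine ⟨_, ⟨hparam, hasMuType_tuple hf hμ hμ1 hfdeg⟩, ?_, ?_⟩
  · obtain ⟨s, -, hs, hiff⟩ := exists_hasGenericDegree (by omega) hparam hC hE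
    rw [hiff, hs (Or.inl (by rwa [hnum])), hmax]
  · rw [mapDegree, hE, RatFunc.finrank_eq_max_natDegree, hmax]

end Tuple

end RationalCurve

theorem proposition4p2 {K : Type*} [Field K] [Infinite K] (n d : ℕ) (hd : 2 ≤ d)
    (μ : Fin d → ℕ) (hμ : Monotone μ) (hμ1 : ∀ i, 1 ≤ μ i) (hμn : ∑ i, μ i = n)
    (k : ℕ) (hk : 1 < k) :
    ((∃ a ∈ RationalCurve.stratum K n d μ, RationalCurve.HasGenericDegree a k) ↔
      ∀ i, k ∣ μ i) ∧
    ((∃ a ∈ RationalCurve.stratum K n d μ, RationalCurve.mapDegree a = k) ↔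
      ∀ i, k ∣ μ i) := by
  have hd1 : 1 ≤ d := by omega
  refine ⟨⟨?_, fun h => ?_⟩, ⟨?_, fun h => ?_⟩⟩
  · rintro ⟨a, ha, hak⟩ i
    exact RationalCurve.dvd_of_hasGenericDegree hd1 ha hak i
  · obtain ⟨a, ha, hak, -⟩ := RationalCurve.exists_stratum_of_dvd (K := K) hd hμ hμ1 hμn hk h
    exact ⟨a, ha, hak⟩
  · rintro ⟨a, ha, rfl⟩ i
    exact RationalCurve.dvd_of_mapDegree hd1 ha i
  · obtain ⟨a, ha, -, hak⟩ := RationalCurve.exists_stratum_of_dvd (K := K) hd hμ hμ1 hμn hk h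
    exact ⟨a, ha, hak⟩
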